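/- Let $\varphi$ and $\Phi$ be the standard normal density and distribution function. For $\theta=(\mu,\sigma,\tau_l,\tau_u)\in\mathbb R^4$ with $\sigma>0$ and $\tau_l<\tau_u$ put $\tau_l^*=(\tau_l-\mu)/\sigma$, $\tau_u^*=(\tau_u-\mu)/\sigma$, and let $\mathrm{TN}(\theta)$ be the truncated normal distribution with density $$f_\theta(t)=\frac{\frac1\sigma\varphi\left(\frac{t-\mu}{\sigma}\right)}{\Phi(\tau_u^*)-\Phi(\tau_l^*)},\qquad t\in[\tau_l,\tau_u],$$ and $f_\theta(t)=0$ otherwise. For $n\ge 2$ let $$h_l=n\,\frac{\Phi(\tau_l^*)}{\Phi(\tau_u^*)-\Phi(\tau_l^*)},\qquad h_u=n\,\frac{1-\Phi(\tau_u^*)}{\Phi(\tau_u^*)-\Phi(\tau_l^*)},$$ and, for $1\le k\le n$, let $c_{n:k}(\theta)=\Phi^{-1}(m_{n,k}(\theta))$, where $m_{n,k}(\theta)$ is the median of the $\mathrm{Beta}(h_l+k,\;h_u+n+1-k)$ distribution. For a sample $X_1,\dots,X_n$ with order statistics $X_{n:1}\le\dots\le X_{n:n}$ and $W_{n:k}=(X_{n:k}-\mu)/\sigma$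 define the observed estimating function $$\Psi_n(\theta)=\begin{pmatrix} \frac1n\sum_{k=1}^n\bigl(X_{n:k}-\mu-\sigma c_{n:k}(\theta)\bigr)\\[2pt] \frac1n\sum_{k=1}^n\bigl(X_{n:k}-\mu-\sigma c_{n:k}(\theta)\bigr)c_{n:k}(\theta)\\[2pt] X_{n:1}-\dfrac{\Phi(W_{n:n})-\Phi(W_{n:1})}{(n-1)\frac1\sigma\varphi(W_{n:1})}-\tau_l\\[6pt] X_{n:n}+\dfrac{\Phi(W_{n:n})-\Phi(W_{n:1})}{(n-1)\frac1\sigma\varphi(W_{n:n})}-\tau_u\end{pmatrix}.$$ **Theorem.** Let the parameter space $\Theta$ be a bounded subset of $\{(\mu,\sigma,\tau_l,\tau_u)\in\mathbb R^4:\sigma>0,\ \tau_l<\tau_u\}$, let $\theta_0=(\mu_0,\sigma_0,\tau_{l0},\tau_{u0})\in\Theta$, and let $X_1,X_2,\dots$ be i.i.d. with distribution $\mathrm{TN}(\theta_0)$. If $(\hat\theta_n)$ is any sequence of estimators with values in $\Theta$ such that $\Psi_n(\hat\theta_n)=o_P(1)$ as $n\to\infty$, then $\hat\theta_n\to\theta_0$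 in probability as $n\to\infty$. -/

import Mathlib

open MeasureTheory ProbabilityTheory Filter

noncomputable section

namespace TruncNormal

/-- Parameter vectors `θ = (μ, σ, τ_l, τ_u)`. -/
abbrev Param : Type := EuclideanSpace ℝ (Fin 4)

namespace Param

/-- Mean of the parent normal distribution. -/
def mu (θ : Param) : ℝ := θ 0

/-- Standard deviation of the parent normal distribution. -/
def sigma (θ : Param) : ℝ := θ 1

/-- Lower truncation bound. -/
def tauL (θ : Param) : ℝ := θ 2

/-- Upper truncation bound. -/
def tauU (θ : Param) : ℝ := θ 3

/-- Standardization `(t - μ) / σ`. -/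
def std (θ : Param) (t : ℝ) : ℝ := (t - θ.mu) / θ.sigma

/-- The admissible parameters: `μ` real, `σ > 0`, `τ_l < τ_u`. -/
def admissible : Set Param := {θ | 0 < θ.sigma ∧ θ.tauL < θ.tauU}

end Param

/-- Standard normal density `φ`. -/
def phi (t : ℝ) : ℝ := gaussianPDFReal 0 1 t

/-- Standard normal distribution function `Φ`. -/
def Phi (t : ℝ) : ℝ := cdf (gaussianReal 0 1) t

/-- Quantile function `p ↦ inf {t | p ≤ F(t)}` of a probability measure on `ℝ` with distribution
function `F` (meaningful for `0 < p < 1`). -/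
def quantile (ν : Measure ℝ) (p : ℝ) : ℝ := sInf {t : ℝ | p ≤ cdf ν t}

/-- `Φ(τ_u*) - Φ(τ_l*)`, the parent probability of the truncation interval. -/
def mass (θ : Param) : ℝ := Phi (θ.std θ.tauU) - Phi (θ.std θ.tauL)

/-- Density of the truncated normal distribution `TN(μ, σ, τ_l, τ_u)`. -/
def truncNormalPDF (θ : Param) (t : ℝ) : ℝ :=
  (Set.Icc θ.tauL θ.tauU).indicator (fun s => (1 / θ.sigma) * phi (θ.std s) / mass θ) t

/-- The truncated normal distribution `TN(μ, σ, τ_l, τ_u)`. -/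
def truncNormal (θ : Param) : Measure ℝ :=
  volume.withDensity (fun t => ENNReal.ofReal (truncNormalPDF θ t))

/-- `orderStat x k` is the `k`-th order statistic `X_{n:k}` of the sample `x = (X_1, …, X_n)`, for
`1 ≤ k ≤ n` (`0` for other `k`). -/
def orderStat {n : ℕ} (x : Fin n → ℝ) (k : ℕ) : ℝ :=
  if h : 1 ≤ k ∧ k ≤ n then x (Tuple.sort x ⟨k - 1, by omega⟩) else 0

/-- `ξ(n, n_l, n_u, k) = Φ⁻¹(G⁻¹(1/2))`, where `G` is the distribution function of
`Beta(n_l + k, n_u + n + 1 - k)`. -/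
def xi (n : ℕ) (nl nu : ℝ) (k : ℕ) : ℝ :=
  quantile (gaussianReal 0 1) (quantile (betaMeasure (nl + k) (nu + n + 1 - k)) (1 / 2))

/-- Expected number of latent observations below `τ_l`: the mean of the negative binomial
distribution of the number of failures before the `n`-th success, with success probability
`(Φ(τ_u*) - Φ(τ_l*)) / Φ(τ_u*)`. -/
def hl (n : ℕ) (θ : Param) : ℝ := n * (Phi (θ.std θ.tauL) / mass θ)

/-- Expected number of latent observations above `τ_u`: the mean of the negative binomial
distribution of the number of failures before the `n`-th success, with success probability
`(Φ(τ_u*) - Φ(τ_l*)) / (1 - Φ(τ_l*))`. -/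
def hu (n : ℕ) (θ : Param) : ℝ := n * ((1 - Phi (θ.std θ.tauU)) / mass θ)

/-- The complete-data estimating function `U^{(1)}(x, n_l, n_u, θ)`. -/
def estU {n : ℕ} (x : Fin n → ℝ) (nl nu : ℝ) (θ : Param) : EuclideanSpace ℝ (Fin 4) :=
  !₂[(n : ℝ)⁻¹ * ∑ k ∈ Finset.Icc 1 n, (orderStat x k - θ.mu - θ.sigma * xi n nl nu k),
    (n : ℝ)⁻¹ * ∑ k ∈ Finset.Icc 1 n,
      (orderStat x k - θ.mu - θ.sigma * xi n nl nu k) * xi n nl nu k,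
    orderStat x 1
      - (Phi (θ.std (orderStat x n)) - Phi (θ.std (orderStat x 1)))
          / (((n : ℝ) - 1) * (1 / θ.sigma) * phi (θ.std (orderStat x 1)))
      - θ.tauL,
    orderStat x n
      + (Phi (θ.std (orderStat x n)) - Phi (θ.std (orderStat x 1)))
          / (((n : ℝ) - 1) * (1 / θ.sigma) * phi (θ.std (orderStat x n)))
      - θ.tauU]

/-- The observed estimating function `U^{obs}(x, θ)`: the latent counts are replaced by their
expectations under `θ`. -/
def obsU {n : ℕ} (x : Fin n → ℝ) (θ : Param) : EuclideanSpace ℝ (Fin 4) :=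
  estU x (hl n θ) (hu n θ) θ

end TruncNormal

end

noncomputable section

namespace TruncNormal

open Set Topology

/-! The argument is compactness plus identification of the limit. By the law of large numbers the
empirical distribution function converges to that of `TN(θ₀)`. Since `Θ` is bounded, approximate
zeros of the estimating function have convergent subsequences, so it suffices to show that a limit
`θ'` along deterministic samples that look like `TN(θ₀)` must be `θ₀` (`ApproxSolution.limit_eq`).
The limit may leave the parameter space: `σ' = 0` has to be excluded.

The corrections in the last two components are nonnegative, so the limiting interval encloses the
true one. If `σ' > 0`, the corrections are of order `1/n` and the intervals agree. An average over
`k` is an integral over `p ∈ (0, 1)` with `k = ⌈n p⌉`, so the first two components pass to the limit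
by dominated convergence: the difference `D` between the true and the fitted quantile function is
orthogonal to the constants and to the increasing limiting score, hence has two zeros
(`exists_two_zeros`). The two distribution functions then cross twice inside the interval and agree
at both ends. By Rolle the densities agree at three points, but the logarithm of their ratio is a
quadratic polynomial, so `μ` and `σ` agree (`mu_sigma_eq_of_two_crossings`).

If `σ' = 0`, bounds on the fitted values that are uniform in the parameter force `μ'` strictly
inside the limiting interval (`ApproxSolution.mu_mem_Ioo`). The truncation then disappears in the
limit and the fitted quantile function becomes the constant `μ'`, which a strictly increasing
function cannot meet twice.

Domination needs control of the scores near `p = 0` and `p = 1`. A Beta median is at least its mean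
divided by 17 (`betaMedian_lower`), and a crude Gaussian tail bound turns this into an envelope of
order `p ^ (-1/4) + (1 - p) ^ (-1/4)`, whose square is integrable. -/

/-! ### The standard normal distribution and its quantile function -/

lemma phi_pos (t : ℝ) : 0 < phi t := gaussianPDFReal_pos 0 1 t one_ne_zero

lemma phi_eq (t : ℝ) : phi t = (√(2 * Real.pi))⁻¹ * Real.exp (-t ^ 2 / 2) := by
  simp [phi, gaussianPDFReal_def]

lemma continuous_phi : Continuous phi := by
  have : phi = fun t => (√(2 * Real.pi))⁻¹ * Real.exp (-t ^ 2 / 2) := funext phi_eq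
  rw [this]; fun_prop

lemma Phi_eq_integral (t : ℝ) : Phi t = ∫ s in Iic t, phi s := by
  rw [Phi, cdf_eq_real, measureReal_def, gaussianReal_apply_eq_integral 0 one_ne_zero,
    ENNReal.toReal_ofReal]
  · rfl
  · exact integral_nonneg fun s => gaussianPDFReal_nonneg 0 1 s

lemma integrable_phi : Integrable phi := integrable_gaussianPDFReal 0 1

lemma Phi_sub_Phi (a b : ℝ) : Phi b - Phi a = ∫ s in a..b, phi s := by
  rw [Phi_eq_integral, Phi_eq_integral,
    intervalIntegral.integral_Iic_sub_Iic integrable_phi.integrableOn integrable_phi.integrableOn]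

lemma hasDerivAt_Phi (t : ℝ) : HasDerivAt Phi (phi t) t := by
  have h : Phi = fun x => Phi 0 + ∫ s in (0 : ℝ)..x, phi s := by
    funext x; rw [← Phi_sub_Phi]; ring
  rw [h]
  exact (intervalIntegral.integral_hasDerivAt_right
    (continuous_phi.intervalIntegrable _ _) (continuous_phi.stronglyMeasurableAtFilter _ _)
    continuous_phi.continuousAt).const_add _

lemma continuous_Phi : Continuous Phi :=
  continuous_iff_continuousAt.2 fun t => (hasDerivAt_Phi t).continuousAt

lemma strictMono_Phi : StrictMono Phi :=
  strictMono_of_deriv_pos fun t => by rw [(hasDerivAt_Phi t).deriv]; exact phi_pos t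

lemma tendsto_Phi_atBot : Tendsto Phi atBot (𝓝 0) := tendsto_cdf_atBot _

lemma tendsto_Phi_atTop : Tendsto Phi atTop (𝓝 1) := tendsto_cdf_atTop _

lemma Phi_pos (t : ℝ) : 0 < Phi t :=
  lt_of_le_of_lt (cdf_nonneg _ (t - 1)) (strictMono_Phi (by linarith : t - 1 < t))

lemma Phi_lt_one (t : ℝ) : Phi t < 1 :=
  lt_of_lt_of_le (strictMono_Phi (by linarith : t < t + 1)) (cdf_le_one _ (t + 1))

lemma Phi_neg (t : ℝ) : Phi (-t) = 1 - Phi t := by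
  have h : (∫ s in Iic t, phi s) + ∫ s in Ioi t, phi s = 1 := by
    have := integral_add_compl (μ := volume) (measurableSet_Iic (a := t)) integrable_phi
    rw [compl_Iic] at this
    rw [this]
    exact integral_gaussianPDFReal_eq_one 0 one_ne_zero
  have h2 : ∫ s in Iic (-t), phi s = ∫ s in Ioi t, phi s := by
    rw [← integral_comp_neg_Ioi]
    simp [phi_eq]
  rw [Phi_eq_integral, Phi_eq_integral, h2]; linarith

/-- The standard normal quantile function `Φ⁻¹`. -/
abbrev Q (p : ℝ) : ℝ := quantile (gaussianReal 0 1) p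

lemma Q_Phi (x : ℝ) : Q (Phi x) = x := by
  have : {t : ℝ | Phi x ≤ cdf (gaussianReal 0 1) t} = Ici x := by
    ext t; exact strictMono_Phi.le_iff_le
  rw [Q, quantile, this, csInf_Ici]

lemma exists_Phi_eq {u : ℝ} (hu : u ∈ Ioo (0 : ℝ) 1) : ∃ x, Phi x = u := by
  obtain ⟨a, ha⟩ := (tendsto_Phi_atBot.eventually (gt_mem_nhds hu.1)).exists
  obtain ⟨b, hb⟩ := (tendsto_Phi_atTop.eventually (lt_mem_nhds hu.2)).exists
  exact mem_range_of_exists_le_of_exists_ge continuous_Phi ⟨a, ha.le⟩ ⟨b, hb.le⟩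

lemma Phi_Q {u : ℝ} (hu : u ∈ Ioo (0 : ℝ) 1) : Phi (Q u) = u := by
  obtain ⟨x, rfl⟩ := exists_Phi_eq hu
  rw [Q_Phi]

lemma le_Q {u x : ℝ} (hu : u ∈ Ioo (0 : ℝ) 1) (h : Phi x ≤ u) : x ≤ Q u := by
  rw [← Phi_Q hu] at h; exact strictMono_Phi.le_iff_le.1 h

lemma Q_le {u x : ℝ} (hu : u ∈ Ioo (0 : ℝ) 1) (h : u ≤ Phi x) : Q u ≤ x := by
  rw [← Phi_Q hu] at h; exact strictMono_Phi.le_iff_le.1 h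

lemma strictMonoOn_Q : StrictMonoOn Q (Ioo 0 1) := fun u hu v hv h => by
  rw [← Phi_Q hu, ← Phi_Q hv] at h; exact strictMono_Phi.lt_iff_lt.1 h

lemma continuousAt_Q {u : ℝ} (hu : u ∈ Ioo (0 : ℝ) 1) : ContinuousAt Q u := by
  rw [ContinuousAt, tendsto_order]
  have hm : ∀ᶠ v in 𝓝 u, v ∈ Ioo (0 : ℝ) 1 := Ioo_mem_nhds hu.1 hu.2
  constructor <;> intro a ha
  · have : Phi a < u := by rw [← Phi_Q hu]; exact strictMono_Phi ha
    filter_upwards [hm, lt_mem_nhds this] with v hv hav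
    rw [← Phi_Q hv] at hav; exact strictMono_Phi.lt_iff_lt.1 hav
  · have : u < Phi a := by rw [← Phi_Q hu]; exact strictMono_Phi ha
    filter_upwards [hm, gt_mem_nhds this] with v hv hav
    rw [← Phi_Q hv] at hav; exact strictMono_Phi.lt_iff_lt.1 hav

/-! ### Gaussian tail bounds -/

/-- After translation, the integrand is `phi (s - d) = phi s * exp (s d - d² / 2)`, and `s ≤ x` on
the domain of integration. -/
lemma Phi_sub_le (x d : ℝ) (hd : 0 ≤ d) :
    Phi (x - d) ≤ Phi x * Real.exp (x * d - d ^ 2 / 2) := by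
  have h1 : Phi (x - d) = ∫ s in Iic x, phi (s - d) := by
    rw [Phi_eq_integral]
    have := (measurePreserving_sub_right volume d).setIntegral_preimage_emb
      (MeasurableEquiv.subRight d).measurableEmbedding phi (Iic (x - d))
    rw [← this]; simp
  rw [h1, Phi_eq_integral, ← integral_mul_const]
  refine setIntegral_mono_on ?_ ?_ measurableSet_Iic fun s hs => ?_
  · exact (integrable_phi.comp_sub_right d).integrableOn
  · exact (integrable_phi.mul_const _).integrableOn
  · rw [phi_eq, phi_eq, mul_assoc, ← Real.exp_add]
    gcongr
    have : s * d ≤ x * d := mul_le_mul_of_nonneg_right hs hd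
    nlinarith

lemma exp_neg_sq_half_le {e : ℝ} (he : 0 < e) : Real.exp (-(e ^ 2 / 2)) ≤ 8 / e ^ 4 := by
  have h := Real.quadratic_le_exp_of_nonneg (by positivity : 0 ≤ e ^ 2 / 2)
  rw [Real.exp_neg, inv_le_comm₀ (Real.exp_pos _) (by positivity), inv_div]
  nlinarith [sq_nonneg e]

/-- Shift by `d = 2 max x 0 + e`. Doubling the positive part absorbs the term `x d`, leaving at most
`exp (-e² / 2) ≤ 8 / e⁴`; then `e` is chosen to make this equal to `r`. The fourth power is what
later makes the envelope square integrable. Keeping `x` arbitrary gives bounds that survive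
multiplication by `σ` as `σ → 0`. -/
lemma Phi_sub_two_pos_part_le (x : ℝ) {r : ℝ} (hr : 0 < r) :
    Phi (x - 2 * max x 0 - (8 / r) ^ (1 / 4 : ℝ)) ≤ Phi x * r := by
  set e := (8 / r) ^ (1 / 4 : ℝ) with he
  have he0 : 0 < e := by positivity
  have he4 : e ^ 4 = 8 / r := by
    rw [he, ← Real.rpow_natCast, ← Real.rpow_mul (by positivity)]; norm_num
  have hm : 0 ≤ max x 0 := le_max_right _ _
  have hx : x ≤ max x 0 := le_max_left _ _
  have h := Phi_sub_le x (2 * max x 0 + e) (by positivity)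
  rw [← sub_sub] at h
  refine h.trans (mul_le_mul_of_nonneg_left ?_ (Phi_pos x).le)
  calc _ ≤ Real.exp (-(e ^ 2 / 2)) := Real.exp_le_exp.2 (by nlinarith)
    _ ≤ 8 / e ^ 4 := exp_neg_sq_half_le he0
    _ = r := by rw [he4]; field_simp

/-- Lower bound for the normal quantile of a number that is not much smaller than `Φ x`. -/
lemma Q_lower {u r : ℝ} (hu : u ∈ Ioo (0 : ℝ) 1) (x : ℝ) (hr : 0 < r) (h : r * Phi x ≤ u) :
    x - 2 * max x 0 - (8 / r) ^ (1 / 4 : ℝ) ≤ Q u :=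
  le_Q hu ((Phi_sub_two_pos_part_le x hr).trans (by linarith))

/-- Upper bound for the normal quantile of `u` if `1 - u` is not much smaller than `1 - Φ x`. -/
lemma Q_upper {u r : ℝ} (hu : u ∈ Ioo (0 : ℝ) 1) (x : ℝ) (hr : 0 < r)
    (h : r * (1 - Phi x) ≤ 1 - u) :
    Q u ≤ x + 2 * max (-x) 0 + (8 / r) ^ (1 / 4 : ℝ) := by
  refine Q_le hu ?_
  have h1 := Phi_sub_two_pos_part_le (-x) hr
  have h2 := Phi_neg (x + 2 * max (-x) 0 + (8 / r) ^ (1 / 4 : ℝ))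
  rw [Phi_neg x] at h1
  rw [show -(x + 2 * max (-x) 0 + (8 / r) ^ (1 / 4 : ℝ))
    = -x - 2 * max (-x) 0 - (8 / r) ^ (1 / 4 : ℝ) by ring] at h2
  linarith

/-! ### Quantiles, and medians of Beta distributions -/

lemma le_quantile {ν : Measure ℝ} {x p : ℝ} (hp : p < 1) (h : cdf ν x < p) :
    x ≤ quantile ν p := by
  -- The condition `p < 1` makes the set nonempty, so that `sInf` does not take its default value.
  refine le_csInf ?_ fun t ht => ?_
  · obtain ⟨b, hb⟩ := ((tendsto_cdf_atTop ν).eventually (lt_mem_nhds hp)).exists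
    exact ⟨b, hb.le⟩
  · by_contra! hlt
    exact absurd ((ht : p ≤ _).trans (monotone_cdf ν hlt.le)) h.not_ge

lemma quantile_le {ν : Measure ℝ} {x p : ℝ} (hp : 0 < p) (h : p ≤ cdf ν x) :
    quantile ν p ≤ x := by
  refine csInf_le ?_ h
  obtain ⟨a, ha⟩ := ((tendsto_cdf_atBot ν).eventually (gt_mem_nhds hp)).exists
  refine ⟨a, fun t ht => ?_⟩
  by_contra! hlt
  exact absurd ((ht : p ≤ _).trans (monotone_cdf ν hlt.le)) ha.not_ge

lemma ae_mem_Ioo_betaMeasure (a b : ℝ) : ∀ᵐ t ∂(betaMeasure a b), t ∈ Ioo (0 : ℝ) 1 := by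
  rw [betaMeasure, ae_withDensity_iff (by unfold betaPDF; fun_prop)]
  refine ae_of_all _ fun t ht => ?_
  by_contra hn
  exact ht (by rw [betaPDF_eq, if_neg (show ¬(0 < t ∧ t < 1) from hn), ENNReal.ofReal_zero])

/-- Moments of the Beta distribution. -/
lemma betaMeasure_moment {a b p q : ℝ} (ha : 0 < a) (hb : 0 < b) (hp : 0 < a + p)
    (hq : 0 < b + q) :
    Integrable (fun t : ℝ => t ^ p * (1 - t) ^ q) (betaMeasure a b) ∧
      ∫ t, t ^ p * (1 - t) ^ q ∂(betaMeasure a b) = beta (a + p) (b + q) / beta a b := by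
  have hR : 0 < beta (a + p) (b + q) / beta a b := div_pos (beta_pos hp hq) (beta_pos ha hb)
  have hl : ∫⁻ t, ENNReal.ofReal (t ^ p * (1 - t) ^ q) ∂(betaMeasure a b)
      = ENNReal.ofReal (beta (a + p) (b + q) / beta a b) := by
    rw [betaMeasure, lintegral_withDensity_eq_lintegral_mul _ (by unfold betaPDF; fun_prop)
      (by fun_prop)]
    -- The factor `t ^ p * (1 - t) ^ q` tilts one Beta density into a multiple of another, whose
    -- total mass is one.
    have : ∀ t : ℝ, (betaPDF a b * fun t => ENNReal.ofReal (t ^ p * (1 - t) ^ q)) t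
        = ENNReal.ofReal (beta (a + p) (b + q) / beta a b) * betaPDF (a + p) (b + q) t := by
      intro t
      by_cases ht : 0 < t ∧ t < 1
      · have h1 : 0 < 1 - t := by linarith [ht.2]
        have e1 := beta_pos ha hb
        have e2 := beta_pos hp hq
        rw [Pi.mul_apply, betaPDF_of_pos_lt_one ht.1 ht.2, betaPDF_of_pos_lt_one ht.1 ht.2,
          ← ENNReal.ofReal_mul, ← ENNReal.ofReal_mul hR.le]
        · congr 1
          rw [show a + p - 1 = (a - 1) + p by ring, show b + q - 1 = (b - 1) + q by ring,
            Real.rpow_add ht.1, Real.rpow_add h1]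
          field_simp
        · have := ht.1
          positivity
      · rw [Pi.mul_apply, betaPDF_eq, betaPDF_eq, if_neg ht, if_neg ht]; simp
    simp_rw [this]
    rw [lintegral_const_mul _ (by unfold betaPDF; fun_prop), lintegral_betaPDF_eq_one hp hq,
      mul_one]
  have hnn : 0 ≤ᵐ[betaMeasure a b] fun t : ℝ => t ^ p * (1 - t) ^ q := by
    filter_upwards [ae_mem_Ioo_betaMeasure a b] with t ht
    exact mul_nonneg (Real.rpow_nonneg ht.1.le _) (Real.rpow_nonneg (by linarith [ht.2]) _)
  have hm : AEStronglyMeasurable (fun t : ℝ => t ^ p * (1 - t) ^ q) (betaMeasure a b) :=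
    Measurable.aestronglyMeasurable (by fun_prop)
  refine ⟨⟨hm, ?_⟩, ?_⟩
  · rw [hasFiniteIntegral_iff_ofReal hnn, hl]; exact ENNReal.ofReal_lt_top
  · rw [integral_eq_lintegral_of_nonneg_ae hnn hm, hl, ENNReal.toReal_ofReal hR.le]

/-- Log-convexity of Gamma at the midpoint of `z` and `z + 1`. -/
lemma Gamma_add_half_le {z : ℝ} (hz : 0 < z) :
    Real.Gamma (z + 1 / 2) ≤ √z * Real.Gamma z := by
  have h := Real.Gamma_mul_add_mul_le_rpow_Gamma_mul_rpow_Gamma (s := z) (t := z + 1)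
    (a := 1 / 2) (b := 1 / 2) hz (by linarith) (by norm_num) (by norm_num) (by norm_num)
  have hG := Real.Gamma_pos_of_pos hz
  rw [show 1 / 2 * z + 1 / 2 * (z + 1) = z + 1 / 2 by ring, Real.Gamma_add_one hz.ne',
    ← Real.sqrt_eq_rpow, ← Real.sqrt_eq_rpow, Real.sqrt_mul hz.le] at h
  calc _ ≤ _ := h
    _ = √z * (√(Real.Gamma z) * √(Real.Gamma z)) := by ring
    _ = _ := by rw [Real.mul_self_sqrt hG.le]

/-- The left side is the moment of order `-1/2` of `Beta(a, b)`, compared here with the same power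
of the mean. The factor 2 comes from `a - 1/2 ≥ a / 2`, which uses `a ≥ 1`. -/
lemma beta_sub_half_div_le {a b : ℝ} (ha : 1 ≤ a) (hb : 0 < b) :
    beta (a + -(1 / 2)) b / beta a b ≤ 2 * √((a + b) / a) := by
  have g1 : 0 < Real.Gamma a := Real.Gamma_pos_of_pos (by linarith)
  have g2 : 0 < Real.Gamma b := Real.Gamma_pos_of_pos hb
  have g3 : 0 < Real.Gamma (a + b) := Real.Gamma_pos_of_pos (by linarith)
  have g4 : 0 < Real.Gamma (a - 1 / 2) := Real.Gamma_pos_of_pos (by linarith)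
  have g5 : 0 < Real.Gamma (a + b - 1 / 2) := Real.Gamma_pos_of_pos (by linarith)
  have k1 : Real.Gamma (a + b) ≤ √(a + b) * Real.Gamma (a + b - 1 / 2) := by
    have := Gamma_add_half_le (z := a + b - 1 / 2) (by linarith)
    rw [sub_add_cancel] at this
    exact this.trans (mul_le_mul_of_nonneg_right (Real.sqrt_le_sqrt (by linarith)) g5.le)
  have k2 : √a * Real.Gamma (a - 1 / 2) ≤ 2 * Real.Gamma a := by
    have h1 := Gamma_add_half_le (z := a) (by linarith)
    have h2 := Real.Gamma_add_one (s := a - 1 / 2) (by linarith)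
    rw [show a - 1 / 2 + 1 = a + 1 / 2 by ring] at h2
    have hs : √a * √a = a := Real.mul_self_sqrt (by linarith)
    have hs0 : 0 < √a := Real.sqrt_pos.2 (by linarith)
    rw [h2] at h1
    have h3 : a / 2 * Real.Gamma (a - 1 / 2) ≤ (a - 1 / 2) * Real.Gamma (a - 1 / 2) :=
      mul_le_mul_of_nonneg_right (by linarith) g4.le
    have h4 : √a * (√a * Real.Gamma (a - 1 / 2)) ≤ √a * (2 * Real.Gamma a) := by
      rw [← mul_assoc, hs]; linarith
    exact le_of_mul_le_mul_left h4 hs0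
  have hs0 : 0 < √a := Real.sqrt_pos.2 (by linarith)
  have e : beta (a + -(1 / 2)) b / beta a b = (Real.Gamma (a - 1 / 2) * Real.Gamma (a + b)) /
      (Real.Gamma a * Real.Gamma (a + b - 1 / 2)) := by
    unfold beta
    rw [show a + -(1 / 2) = a - 1 / 2 by ring, show a - 1 / 2 + b = a + b - 1 / 2 by ring]
    field_simp
  rw [e, Real.sqrt_div (by linarith), div_le_iff₀ (by positivity), mul_div_assoc']
  rw [div_mul_eq_mul_div, le_div_iff₀ hs0]
  calc _ = (√a * Real.Gamma (a - 1 / 2)) * Real.Gamma (a + b) := by ring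
    _ ≤ (2 * Real.Gamma a) * (√(a + b) * Real.Gamma (a + b - 1 / 2)) := by gcongr
    _ = _ := by ring

lemma beta_comm (a b : ℝ) : beta a b = beta b a := by
  unfold beta; rw [mul_comm, add_comm]

/-- The median of the Beta distribution. -/
abbrev betaMedian (a b : ℝ) : ℝ := quantile (betaMeasure a b) (1 / 2)

/-- Markov's inequality for `f ^ (-1/2)` bounds the probability by `2 / √17`. The constant 17 is the
first integer for which this is below `1/2`. -/
lemma measureReal_lt_half_of_inv_sqrt_moment {ν : Measure ℝ} [IsProbabilityMeasure ν]
    {f : ℝ → ℝ} {w : ℝ} (hw : 0 < w) (hf : ∀ᵐ t ∂ν, 0 < f t)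
    (hintg : Integrable (fun t => f t ^ (-(1 / 2) : ℝ)) ν)
    (hE : ∫ t, f t ^ (-(1 / 2) : ℝ) ∂ν ≤ 2 * √(w⁻¹)) :
    ν.real {t | f t ≤ w / 17} < 1 / 2 := by
  have hs : 0 < √(w⁻¹) := Real.sqrt_pos.2 (by positivity)
  have hmk := mul_meas_ge_le_integral_of_nonneg (μ := ν) (f := fun t => f t ^ (-(1 / 2) : ℝ))
    (by filter_upwards [hf] with t ht; exact Real.rpow_nonneg ht.le _) hintg
    ((w / 17) ^ (-(1 / 2) : ℝ))
  have hle : ν.real {t | f t ≤ w / 17}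
      ≤ ν.real {t | (w / 17) ^ (-(1 / 2) : ℝ) ≤ f t ^ (-(1 / 2) : ℝ)} := by
    refine ENNReal.toReal_mono (measure_ne_top _ _) (measure_mono_ae ?_)
    filter_upwards [hf] with t ht h
    exact Real.rpow_le_rpow_of_nonpos ht h (by norm_num)
  have hv : (w / 17) ^ (-(1 / 2) : ℝ) = √17 * √(w⁻¹) := by
    rw [Real.rpow_neg (by positivity), ← Real.sqrt_eq_rpow, ← Real.sqrt_inv,
      ← Real.sqrt_mul (by norm_num)]
    congr 1; field_simp
  have h17 : (4 : ℝ) < √17 := by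
    rw [Real.lt_sqrt (by norm_num)]; norm_num
  rw [hv] at hmk hle
  set m := ν.real {t | √17 * √(w⁻¹) ≤ f t ^ (-(1 / 2) : ℝ)}
  have : √17 * m ≤ 2 := by
    have h := hmk.trans hE
    rw [mul_assoc, mul_comm √(w⁻¹), ← mul_assoc] at h
    exact le_of_mul_le_mul_right h hs
  by_contra! hc
  nlinarith

lemma betaMedian_lower {a b : ℝ} (ha : 1 ≤ a) (hb : 1 ≤ b) :
    a / (a + b) / 17 ≤ betaMedian a b := by
  have ha0 : 0 < a := by linarith
  have hb0 : 0 < b := by linarith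
  have := isProbabilityMeasureBeta ha0 hb0
  obtain ⟨h1, h2⟩ := betaMeasure_moment (p := -(1 / 2)) (q := 0) ha0 hb0 (by linarith)
    (by linarith)
  simp only [Real.rpow_zero, mul_one, add_zero] at h1 h2
  refine le_quantile (by norm_num) ?_
  rw [cdf_eq_real]
  refine measureReal_lt_half_of_inv_sqrt_moment (f := fun t => t) (by positivity) ?_ h1 ?_
  · filter_upwards [ae_mem_Ioo_betaMeasure a b] with t ht using ht.1
  · rw [h2, inv_div]; exact beta_sub_half_div_le ha hb0

lemma betaMedian_upper {a b : ℝ} (ha : 1 ≤ a) (hb : 1 ≤ b) :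
    b / (a + b) / 17 ≤ 1 - betaMedian a b := by
  have ha0 : 0 < a := by linarith
  have hb0 : 0 < b := by linarith
  have := isProbabilityMeasureBeta ha0 hb0
  obtain ⟨h1, h2⟩ := betaMeasure_moment (p := 0) (q := -(1 / 2)) ha0 hb0 (by linarith)
    (by linarith)
  simp only [Real.rpow_zero, one_mul, add_zero] at h1 h2
  have hh : betaMedian a b ≤ 1 - b / (a + b) / 17 := by
    refine quantile_le (by norm_num) ?_
    have := measureReal_lt_half_of_inv_sqrt_moment (ν := betaMeasure a b) (f := fun t => 1 - t)
      (w := b / (a + b)) (by positivity) ?_ h1 ?_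
    · rw [cdf_eq_real]
      have hc : (betaMeasure a b).real (Iic (1 - b / (a + b) / 17))ᶜ < 1 / 2 := by
        refine lt_of_le_of_lt (measureReal_mono ?_) this
        intro t ht
        simp only [compl_Iic, mem_Ioi, mem_ofPred_eq] at ht ⊢
        linarith
      rw [probReal_compl_eq_one_sub measurableSet_Iic] at hc
      linarith
    · filter_upwards [ae_mem_Ioo_betaMeasure a b] with t ht
      linarith [ht.2]
    · rw [h2, inv_div, beta_comm, beta_comm a, add_comm a b]; exact beta_sub_half_div_le hb ha0
  linarith

lemma betaMeasure_variance_le {a b : ℝ} (ha : 0 < a) (hb : 0 < b) :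
    Integrable (fun t : ℝ => (t - a / (a + b)) ^ 2) (betaMeasure a b) ∧
      ∫ t, (t - a / (a + b)) ^ 2 ∂(betaMeasure a b) ≤ 1 / (4 * (a + b)) := by
  have := isProbabilityMeasureBeta ha hb
  obtain ⟨i1, e1⟩ := betaMeasure_moment (p := 1) (q := 0) ha hb (by linarith) (by linarith)
  obtain ⟨i2, e2⟩ := betaMeasure_moment (p := 2) (q := 0) ha hb (by linarith) (by linarith)
  simp only [Real.rpow_zero, mul_one, add_zero, Real.rpow_one, Real.rpow_two] at i1 e1 i2 e2
  have g1 : 0 < Real.Gamma a := Real.Gamma_pos_of_pos ha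
  have g2 : 0 < Real.Gamma b := Real.Gamma_pos_of_pos hb
  have g3 : 0 < Real.Gamma (a + b) := Real.Gamma_pos_of_pos (by linarith)
  have r1 : beta (a + 1) b / beta a b = a / (a + b) := by
    unfold beta
    rw [show a + 1 + b = a + b + 1 by ring, Real.Gamma_add_one ha.ne',
      Real.Gamma_add_one (by linarith)]
    field_simp
  have r2 : beta (a + 2) b / beta a b = a * (a + 1) / ((a + b) * (a + b + 1)) := by
    unfold beta
    rw [show a + 2 + b = a + b + 1 + 1 by ring, show a + 2 = a + 1 + 1 by ring,
      Real.Gamma_add_one (by linarith), Real.Gamma_add_one ha.ne',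
      Real.Gamma_add_one (by linarith), Real.Gamma_add_one (by linarith)]
    field_simp
  have hexp : (fun t : ℝ => (t - a / (a + b)) ^ 2)
      = fun t => t ^ 2 - 2 * (a / (a + b)) * t + (a / (a + b)) ^ 2 := by
    funext t; ring
  have i3 : Integrable (fun t : ℝ => t ^ 2 - 2 * (a / (a + b)) * t) (betaMeasure a b) :=
    i2.sub (i1.const_mul _)
  rw [hexp]
  refine ⟨i3.add (integrable_const _), ?_⟩
  rw [integral_add i3 (integrable_const _), integral_sub i2 (i1.const_mul _),
    integral_const_mul, e1, e2, r1, r2]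
  simp only [integral_const, probReal_univ, smul_eq_mul, one_mul]
  have : a * (a + 1) / ((a + b) * (a + b + 1)) - 2 * (a / (a + b)) * (a / (a + b))
      + (a / (a + b)) ^ 2 = a * b / ((a + b) ^ 2 * (a + b + 1)) := by
    field_simp; ring
  rw [this, div_le_div_iff₀ (by positivity) (by positivity)]
  have h4 : 4 * (a * b) ≤ (a + b) ^ 2 := by nlinarith [sq_nonneg (a - b)]
  calc a * b * (4 * (a + b)) = 4 * (a * b) * (a + b) := by ring
    _ ≤ (a + b) ^ 2 * (a + b) := by gcongr
    _ ≤ _ := by nlinarith [sq_nonneg (a + b)]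

/-- The median of the Beta distribution is close to its mean. -/
lemma abs_betaMedian_sub_mean_le {a b : ℝ} (ha : 0 < a) (hb : 0 < b) :
    |betaMedian a b - a / (a + b)| ≤ 1 / √(a + b) := by
  have := isProbabilityMeasureBeta ha hb
  obtain ⟨h1, h2⟩ := betaMeasure_variance_le ha hb
  set m := a / (a + b)
  have hs : 0 < 1 / √(a + b) := by positivity
  have hs2 : (1 / √(a + b)) ^ 2 = 1 / (a + b) := by
    rw [div_pow, Real.sq_sqrt (by positivity), one_pow]
  have hmk := (mul_meas_ge_le_integral_of_nonneg (μ := betaMeasure a b)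
    (f := fun t => (t - m) ^ 2) (ae_of_all _ fun t => sq_nonneg _) h1
    ((1 / √(a + b)) ^ 2)).trans h2
  set s := 1 / √(a + b) with hsdef
  set V := (betaMeasure a b).real {t | s ^ 2 ≤ (t - m) ^ 2}
  -- Chebyshev's inequality with radius `1 / √(a + b)`, at least twice the standard deviation,
  -- leaves at most `1/4 < 1/2` outside.
  have hV : V ≤ 1 / 4 := by
    rw [hs2] at hmk
    have : (1 : ℝ) / (4 * (a + b)) = 1 / (a + b) * (1 / 4) := by field_simp
    rw [this] at hmk
    exact le_of_mul_le_mul_left hmk (by positivity)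
  rw [abs_sub_le_iff]
  constructor
  · have : betaMedian a b ≤ m + s := by
      refine quantile_le (by norm_num) ?_
      have hc : (betaMeasure a b).real (Iic (m + s))ᶜ ≤ V := by
        refine measureReal_mono fun t ht => ?_
        simp only [compl_Iic, mem_Ioi, mem_ofPred_eq] at ht ⊢
        nlinarith
      rw [probReal_compl_eq_one_sub measurableSet_Iic] at hc
      rw [cdf_eq_real]; linarith
    linarith
  · have : m - s ≤ betaMedian a b := by
      refine le_quantile (by norm_num) ?_
      have hc : (betaMeasure a b).real (Iic (m - s)) ≤ V := by
        refine measureReal_mono fun t ht => ?_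
        simp only [mem_Iic, mem_ofPred_eq] at ht ⊢
        nlinarith
      rw [cdf_eq_real]; linarith
    linarith

/-! ### Averages as integrals, order statistics and the empirical distribution function -/

/-- The function `p ↦ ⌈n p⌉₊` equals `k + 1` on `(k / n, (k + 1) / n]`. Averages for all sample
sizes thus live on one measure space, where dominated convergence applies. -/
lemma average_eq_integral {n : ℕ} (hn : 0 < n) (f : ℕ → ℝ) :
    (n : ℝ)⁻¹ * ∑ k ∈ Finset.Icc 1 n, f k = ∫ p in (0 : ℝ)..1, f ⌈n * p⌉₊ := by
  have hn' : (0 : ℝ) < n := by exact_mod_cast hn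
  have hcongr : ∀ k : ℕ, EqOn (fun _ : ℝ => f (k + 1)) (fun p : ℝ => f ⌈n * p⌉₊)
      (uIoc ((k : ℝ) / n) (((k + 1 : ℕ) : ℝ) / n)) := by
    intro k p hp
    rw [uIoc_of_le (by gcongr; simp)] at hp
    have h1 : (k : ℝ) < n * p := by have := (div_lt_iff₀' hn').1 hp.1; linarith
    have h2 : (n : ℝ) * p ≤ ((k + 1 : ℕ) : ℝ) := by have := (le_div_iff₀' hn').1 hp.2; linarith
    have : ⌈(n : ℝ) * p⌉₊ = k + 1 := by
      rw [Nat.ceil_eq_iff (by omega)]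
      exact ⟨by simpa using h1, h2⟩
    simp only [this]
  have hintg : ∀ k < n, IntervalIntegrable (fun p : ℝ => f ⌈n * p⌉₊) volume
      ((k : ℝ) / n) (((k + 1 : ℕ) : ℝ) / n) := fun k _ =>
    (intervalIntegrable_const (c := f (k + 1))).congr (hcongr k)
  have hsum := intervalIntegral.sum_integral_adjacent_intervals
    (a := fun k : ℕ => (k : ℝ) / n) hintg
  simp only [Nat.cast_zero, zero_div, div_self hn'.ne'] at hsum
  rw [← hsum, Finset.mul_sum, Finset.range_eq_Ico,
    show Finset.Icc 1 n = Finset.Ico (0 + 1) (n + 1) by ext; simp,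
    ← Finset.sum_Ico_add' (fun k => (n : ℝ)⁻¹ * f k)]
  refine Finset.sum_congr rfl fun k _ => ?_
  rw [← intervalIntegral.integral_congr_ae (ae_of_all _ fun p hp => hcongr k hp),
    intervalIntegral.integral_const]
  push_cast
  simp only [smul_eq_mul]
  field_simp
  ring

lemma average_eq_setIntegral {n : ℕ} (hn : 0 < n) (f : ℕ → ℝ) :
    (n : ℝ)⁻¹ * ∑ k ∈ Finset.Icc 1 n, f k = ∫ p in Ioo (0 : ℝ) 1, f ⌈n * p⌉₊ := by
  rw [average_eq_integral hn, intervalIntegral.integral_of_le zero_le_one,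
    integral_Ioc_eq_integral_Ioo]

lemma ceil_mem {n : ℕ} (hn : 0 < n) {p : ℝ} (hp : p ∈ Ioo (0 : ℝ) 1) :
    1 ≤ ⌈n * p⌉₊ ∧ ⌈n * p⌉₊ ≤ n := by
  have hn' : (0 : ℝ) < n := by exact_mod_cast hn
  constructor
  · exact Nat.ceil_pos.2 (mul_pos hn' hp.1)
  · exact Nat.ceil_le.2 (by nlinarith [hp.2])

lemma measurable_comp_ceil (n : ℕ) (f : ℕ → ℝ) : Measurable fun p : ℝ => f ⌈n * p⌉₊ :=
  (measurable_from_nat (f := f)).comp (Nat.measurable_ceil.comp (by fun_prop))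

lemma integrableOn_comp_ceil {n : ℕ} (hn : 0 < n) (f : ℕ → ℝ) :
    IntegrableOn (fun p : ℝ => f ⌈n * p⌉₊) (Ioo 0 1) := by
  refine Measure.integrableOn_of_bounded (M := ∑ k ∈ Finset.Icc 1 n, |f k|) (by simp)
    (measurable_comp_ceil n f).aestronglyMeasurable ?_
  filter_upwards [ae_restrict_mem measurableSet_Ioo] with p hp
  exact Finset.single_le_sum (f := fun k => |f k|) (fun k _ => abs_nonneg _)
    (Finset.mem_Icc.2 (ceil_mem hn hp))

/-- This links order statistics to the empirical distribution function. The zero-based position `k -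
1` has `k` positions at or below it and `k - 1` strictly below. -/
lemma orderStat_le_iff {n : ℕ} (x : Fin n → ℝ) {k : ℕ} (hk : 1 ≤ k ∧ k ≤ n) (t : ℝ) :
    orderStat x k ≤ t ↔ k ≤ (Finset.univ.filter fun i => x i ≤ t).card := by
  have hcard : (Finset.univ.filter fun i => x i ≤ t).card
      = (Finset.univ.filter fun i => x (Tuple.sort x i) ≤ t).card := by
    symm
    refine Finset.card_bij (fun i _ => Tuple.sort x i) ?_ ?_ ?_
    · intro i hi; simpa using hi
    · intro i _ j _ h; exact (Tuple.sort x).injective h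
    · intro j hj
      exact ⟨(Tuple.sort x).symm j, by simpa using hj, by simp⟩
  have hmono : Monotone fun i => x (Tuple.sort x i) := Tuple.monotone_sort x
  rw [hcard, orderStat, dif_pos hk]
  constructor
  · intro h
    have hsub : Finset.Iic (⟨k - 1, by omega⟩ : Fin n)
        ⊆ Finset.univ.filter fun i => x (Tuple.sort x i) ≤ t := by
      intro i hi
      simp only [Finset.mem_filter, Finset.mem_univ, true_and]
      exact (hmono (Finset.mem_Iic.1 hi)).trans h
    have := Finset.card_le_card hsub
    rw [Fin.card_Iic] at this
    simp only at this
    omega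
  · intro h
    by_contra! hlt
    have hsub : (Finset.univ.filter fun i => x (Tuple.sort x i) ≤ t)
        ⊆ Finset.Iio (⟨k - 1, by omega⟩ : Fin n) := by
      intro i hi
      simp only [Finset.mem_filter, Finset.mem_univ, true_and] at hi
      rw [Finset.mem_Iio]
      by_contra! hge
      exact absurd (hlt.trans_le (hmono hge)) hi.not_gt
    have := Finset.card_le_card hsub
    rw [Fin.card_Iio] at this
    simp only at this
    omega

lemma exists_orderStat_eq {n : ℕ} (x : Fin n → ℝ) {k : ℕ} (hk : 1 ≤ k ∧ k ≤ n) :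
    ∃ i, orderStat x k = x i := by
  rw [orderStat, dif_pos hk]; exact ⟨_, rfl⟩

lemma orderStat_mono {n : ℕ} (x : Fin n → ℝ) {k l : ℕ} (hk : 1 ≤ k) (hkl : k ≤ l) (hl : l ≤ n) :
    orderStat x k ≤ orderStat x l := by
  rw [orderStat, dif_pos ⟨hk, by omega⟩, orderStat, dif_pos ⟨by omega, hl⟩]
  refine Tuple.monotone_sort x ?_
  rw [Fin.mk_le_mk]; omega

/-- The empirical distribution function of a sample. -/
def ecdf {n : ℕ} (x : Fin n → ℝ) (t : ℝ) : ℝ :=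
  ((Finset.univ.filter fun i => x i ≤ t).card : ℝ) / n

/-! ### The truncated normal quantile function -/

/-- The quantile function of `TN(θ)`. -/
def truncQuantile (θ : Param) (p : ℝ) : ℝ :=
  θ.mu + θ.sigma * Q (Phi (θ.std θ.tauL) + p * mass θ)

/-- The distribution function of `TN(θ)` on the truncation interval. -/
def truncCDF (θ : Param) (t : ℝ) : ℝ := (Phi (θ.std t) - Phi (θ.std θ.tauL)) / mass θ

lemma std_strictMono {θ : Param} (hθ : θ ∈ Param.admissible) : StrictMono θ.std := by
  intro s t h
  exact div_lt_div_of_pos_right (by linarith) hθ.1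

lemma mass_pos {θ : Param} (hθ : θ ∈ Param.admissible) : 0 < mass θ :=
  sub_pos.2 (strictMono_Phi (std_strictMono hθ hθ.2))

lemma mass_lt_one {θ : Param} : mass θ < 1 := by
  have := Phi_lt_one (θ.std θ.tauU)
  have := Phi_pos (θ.std θ.tauL)
  unfold mass; linarith

/-- The formula is not clamped outside the truncation interval, so it is strictly increasing on the
whole line and comparisons need no case distinction. -/
lemma truncCDF_strictMono {θ : Param} (hθ : θ ∈ Param.admissible) : StrictMono (truncCDF θ) := by
  intro s t h
  have := strictMono_Phi (std_strictMono hθ h)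
  exact div_lt_div_of_pos_right (by linarith) (mass_pos hθ)

lemma truncCDF_tauL (θ : Param) : truncCDF θ θ.tauL = 0 := by simp [truncCDF]

lemma truncCDF_tauU {θ : Param} (hθ : θ ∈ Param.admissible) : truncCDF θ θ.tauU = 1 :=
  div_self (mass_pos hθ).ne'

lemma add_mul_mem_Ioo {a b p : ℝ} (ha : 0 ≤ a) (hb : b ≤ 1) (hab : a < b)
    (hp : p ∈ Ioo (0 : ℝ) 1) : a + p * (b - a) ∈ Ioo (0 : ℝ) 1 := by
  have h0 : 0 < b - a := sub_pos.2 hab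
  have h1 : 0 < p * (b - a) := mul_pos hp.1 h0
  have h2 : p * (b - a) < 1 * (b - a) := mul_lt_mul_of_pos_right hp.2 h0
  constructor <;> linarith

lemma truncCDF_truncQuantile {θ : Param} (hθ : θ ∈ Param.admissible) {p : ℝ}
    (hp : p ∈ Ioo (0 : ℝ) 1) : truncCDF θ (truncQuantile θ p) = p := by
  have h0 := mass_pos hθ
  have hmem : Phi (θ.std θ.tauL) + p * mass θ ∈ Ioo (0 : ℝ) 1 :=
    add_mul_mem_Ioo (Phi_pos _).le (Phi_lt_one _).le (sub_pos.1 h0) hp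
  have hs : θ.std (truncQuantile θ p) = Q (Phi (θ.std θ.tauL) + p * mass θ) := by
    have := hθ.1.ne'
    rw [Param.std, truncQuantile, add_sub_cancel_left, mul_div_cancel_left₀ _ this]
  rw [truncCDF, hs, Phi_Q hmem]; field_simp; ring

lemma truncQuantile_mem {θ : Param} (hθ : θ ∈ Param.admissible) {p : ℝ}
    (hp : p ∈ Ioo (0 : ℝ) 1) : truncQuantile θ p ∈ Ioo θ.tauL θ.tauU := by
  have h := truncCDF_truncQuantile hθ hp
  have hm := truncCDF_strictMono hθ
  constructor
  · rw [← hm.lt_iff_lt, h, truncCDF_tauL]; exact hp.1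
  · rw [← hm.lt_iff_lt, h, truncCDF_tauU hθ]; exact hp.2

lemma truncQuantile_strictMonoOn {θ : Param} (hθ : θ ∈ Param.admissible) :
    StrictMonoOn (truncQuantile θ) (Ioo 0 1) := by
  intro p hp q hq h
  rw [← (truncCDF_strictMono hθ).lt_iff_lt, truncCDF_truncQuantile hθ hp,
    truncCDF_truncQuantile hθ hq]
  exact h

lemma continuousOn_Q_affine {a b : ℝ} (ha : 0 ≤ a) (hb : b ≤ 1) (hab : a < b) :
    ContinuousOn (fun p => Q (a + p * (b - a))) (Ioo 0 1) := fun p hp =>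
  (ContinuousAt.comp (f := fun p => a + p * (b - a)) (continuousAt_Q (add_mul_mem_Ioo ha hb hab hp))
    (by fun_prop)).continuousWithinAt

lemma strictMonoOn_Q_affine {a b : ℝ} (ha : 0 ≤ a) (hb : b ≤ 1) (hab : a < b) :
    StrictMonoOn (fun p => Q (a + p * (b - a))) (Ioo 0 1) := fun p hp q hq h =>
  strictMonoOn_Q (add_mul_mem_Ioo ha hb hab hp) (add_mul_mem_Ioo ha hb hab hq)
    (by have := mul_lt_mul_of_pos_right h (sub_pos.2 hab); linarith)

lemma continuousOn_truncQuantile {θ : Param} (hθ : θ ∈ Param.admissible) :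
    ContinuousOn (truncQuantile θ) (Ioo 0 1) :=
  continuousOn_const.add (continuousOn_const.mul
    (continuousOn_Q_affine (Phi_pos _).le (Phi_lt_one _).le (sub_pos.1 (mass_pos hθ))))

/-! ### Convergence of order statistics -/

lemma tendsto_ceil_div {n : ℕ → ℕ} (hn : Tendsto n atTop atTop) {p : ℝ} (hp : 0 ≤ p) :
    Tendsto (fun j => (⌈(n j : ℝ) * p⌉₊ : ℝ) / n j) atTop (𝓝 p) := by
  have := (tendsto_nat_ceil_mul_div_atTop hp).comp
    ((tendsto_natCast_atTop_atTop (R := ℝ)).comp hn)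
  simpa [Function.comp_def, mul_comm] using this

section OrderStat

variable {θ : Param} {n : ℕ → ℕ} {x : ∀ j, Fin (n j) → ℝ}

/-- The quantile is squeezed between rational points. Using only rationals keeps the number of
convergence conditions countable, as sequential arguments later require. -/
lemma tendsto_orderStat_ceil (hθ : θ ∈ Param.admissible)
    (hn : Tendsto n atTop atTop)
    (hx : ∀ t : ℚ, (t : ℝ) ∈ Ioo θ.tauL θ.tauU →
      Tendsto (fun j => ecdf (x j) t) atTop (𝓝 (truncCDF θ t)))
    {p : ℝ} (hp : p ∈ Ioo (0 : ℝ) 1) :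
    Tendsto (fun j => orderStat (x j) ⌈(n j : ℝ) * p⌉₊) atTop (𝓝 (truncQuantile θ p)) := by
  have hq := truncQuantile_mem hθ hp
  have hF := truncCDF_truncQuantile hθ hp
  have hm := truncCDF_strictMono hθ
  have hpos : ∀ᶠ j in atTop, 0 < n j := hn.eventually_gt_atTop 0
  rw [tendsto_order]
  constructor
  · intro a ha
    obtain ⟨t, ht1, ht2⟩ := exists_rat_btwn (max_lt ha hq.1)
    have hlt : truncCDF θ t < p := by rw [← hF]; exact hm ht2
    filter_upwards [hpos, (hx t ⟨(le_max_right _ _).trans_lt ht1, ht2.trans hq.2⟩).eventually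
      (gt_mem_nhds hlt)] with j hj hj2
    by_contra! hle
    have h1 := (orderStat_le_iff (x j) (ceil_mem hj hp) t).1
      (hle.trans ((le_max_left _ _).trans ht1.le))
    have hj' : (0 : ℝ) < n j := by exact_mod_cast hj
    rw [ecdf, div_lt_iff₀ hj'] at hj2
    have h2 := (Nat.le_ceil ((n j : ℝ) * p)).trans (Nat.cast_le.2 h1)
    linarith
  · intro b hb
    obtain ⟨t, ht1, ht2⟩ := exists_rat_btwn (lt_min hb hq.2)
    have hlt : p < truncCDF θ t := by rw [← hF]; exact hm ht1
    filter_upwards [hpos, (tendsto_ceil_div hn hp.1.le).eventually_lt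
      (hx t ⟨hq.1.trans ht1, ht2.trans_le (min_le_right _ _)⟩) hlt] with j hj hj2
    have hj' : (0 : ℝ) < n j := by exact_mod_cast hj
    refine lt_of_le_of_lt ((orderStat_le_iff (x j) (ceil_mem hj hp) t).2 ?_)
      (ht2.trans_le (min_le_left _ _))
    rw [ecdf, div_lt_div_iff_of_pos_right hj'] at hj2
    exact_mod_cast hj2.le

lemma tendsto_orderStat_one (hθ : θ ∈ Param.admissible)
    (hn : Tendsto n atTop atTop) (hmem : ∀ᶠ j in atTop, ∀ i, x j i ∈ Icc θ.tauL θ.tauU)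
    (hx : ∀ t : ℚ, (t : ℝ) ∈ Ioo θ.tauL θ.tauU →
      Tendsto (fun j => ecdf (x j) t) atTop (𝓝 (truncCDF θ t))) :
    Tendsto (fun j => orderStat (x j) 1) atTop (𝓝 θ.tauL) := by
  have hpos : ∀ᶠ j in atTop, 0 < n j := hn.eventually_gt_atTop 0
  rw [tendsto_order]
  constructor
  · intro a ha
    filter_upwards [hpos, hmem] with j hj hmem
    obtain ⟨i, hi⟩ := exists_orderStat_eq (x j) ⟨le_rfl, hj⟩
    rw [hi]; exact ha.trans_le (hmem i).1
  · intro b hb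
    obtain ⟨t, ht1, ht2⟩ := exists_rat_btwn (lt_min hb hθ.2)
    have hlt : 0 < truncCDF θ t := by rw [← truncCDF_tauL θ]; exact truncCDF_strictMono hθ ht1
    filter_upwards [hpos, (hx t ⟨ht1, ht2.trans_le (min_le_right _ _)⟩).eventually
      (lt_mem_nhds hlt)] with j hj hj2
    refine lt_of_le_of_lt ((orderStat_le_iff (x j) ⟨le_rfl, hj⟩ t).2 ?_)
      (ht2.trans_le (min_le_left _ _))
    by_contra! h0
    rw [ecdf, Nat.lt_one_iff.1 h0] at hj2
    simp at hj2

lemma tendsto_orderStat_last (hθ : θ ∈ Param.admissible)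
    (hn : Tendsto n atTop atTop) (hmem : ∀ᶠ j in atTop, ∀ i, x j i ∈ Icc θ.tauL θ.tauU)
    (hx : ∀ t : ℚ, (t : ℝ) ∈ Ioo θ.tauL θ.tauU →
      Tendsto (fun j => ecdf (x j) t) atTop (𝓝 (truncCDF θ t))) :
    Tendsto (fun j => orderStat (x j) (n j)) atTop (𝓝 θ.tauU) := by
  have hpos : ∀ᶠ j in atTop, 0 < n j := hn.eventually_gt_atTop 0
  rw [tendsto_order]
  constructor
  · intro a ha
    obtain ⟨t, ht1, ht2⟩ := exists_rat_btwn (max_lt ha hθ.2)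
    have hlt : truncCDF θ t < 1 := by rw [← truncCDF_tauU hθ]; exact truncCDF_strictMono hθ ht2
    filter_upwards [hpos, (hx t ⟨(le_max_right _ _).trans_lt ht1, ht2⟩).eventually
      (gt_mem_nhds hlt)] with j hj hj2
    by_contra! hle
    have h1 := (orderStat_le_iff (x j) ⟨hj, le_rfl⟩ t).1
      (hle.trans ((le_max_left _ _).trans ht1.le))
    have hj' : (0 : ℝ) < n j := by exact_mod_cast hj
    rw [ecdf, div_lt_iff₀ hj', one_mul] at hj2
    exact absurd h1 (by exact_mod_cast hj2.not_ge)
  · intro b hb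
    filter_upwards [hpos, hmem] with j hj hmem
    obtain ⟨i, hi⟩ := exists_orderStat_eq (x j) ⟨hj, le_rfl⟩
    rw [hi]; exact (hmem i).2.trans_lt hb

end OrderStat

/-! ### Sign changes and identifiability -/

lemma pos_or_neg_of_ne_zero {g : ℝ → ℝ} {a b : ℝ} (hg : ContinuousOn g (Ioo a b))
    (h0 : ∀ p ∈ Ioo a b, g p ≠ 0) :
    (∀ p ∈ Ioo a b, 0 < g p) ∨ ∀ p ∈ Ioo a b, g p < 0 := by
  by_contra! hcon
  obtain ⟨⟨p, hp, hp0⟩, q, hq, hq0⟩ := hcon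
  obtain ⟨r, hr, hr0⟩ := isPreconnected_Ioo.intermediate_value hp hq hg ⟨hp0, hq0⟩
  exact h0 r hr hr0

lemma integral_pos_of_pos_off_point {f : ℝ → ℝ} (hf : IntegrableOn f (Ioo 0 1)) {p₀ : ℝ}
    (hpos : ∀ p ∈ Ioo (0 : ℝ) 1, p ≠ p₀ → 0 < f p) : 0 < ∫ p in Ioo (0 : ℝ) 1, f p := by
  have hae : ∀ᵐ p ∂(volume.restrict (Ioo (0 : ℝ) 1)), 0 < f p := by
    filter_upwards [ae_restrict_mem measurableSet_Ioo,
      ae_restrict_of_ae (Measure.ae_ne volume p₀)] with p hp hne using hpos p hp hne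
  rw [integral_pos_iff_support_of_nonneg_ae (hae.mono fun p hp => hp.le) hf]
  have : volume.restrict (Ioo (0 : ℝ) 1) (Function.support f)
      = volume.restrict (Ioo (0 : ℝ) 1) univ :=
    measure_congr (by
      filter_upwards [hae] with p hp
      exact propext ⟨fun _ => trivial, fun _ => hp.ne'⟩)
  rw [this]; simp

/-- A continuous function that is orthogonal on `(0, 1)` to the constants and to a strictly
increasing function has at least two zeros. -/
lemma exists_two_zeros {D c : ℝ → ℝ} (hD : ContinuousOn D (Ioo 0 1))
    (hc : StrictMonoOn c (Ioo 0 1)) (hDi : IntegrableOn D (Ioo 0 1))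
    (hDci : IntegrableOn (fun p => D p * c p) (Ioo 0 1))
    (h0 : ∫ p in Ioo (0 : ℝ) 1, D p = 0) (h1 : ∫ p in Ioo (0 : ℝ) 1, D p * c p = 0) :
    ∃ p ∈ Ioo (0 : ℝ) 1, ∃ q ∈ Ioo (0 : ℝ) 1, p < q ∧ D p = 0 ∧ D q = 0 := by
  by_contra! hcon
  -- With at most one zero, `D` has constant sign on each side of some `p₀`. Equal signs contradict
  -- `h0`; opposite signs make `D * (c - c p₀)` of one sign off `p₀`, although its integral
  -- vanishes.
  obtain ⟨p₀, hp₀, hne⟩ : ∃ p₀ ∈ Ioo (0 : ℝ) 1, ∀ p ∈ Ioo (0 : ℝ) 1, p ≠ p₀ → D p ≠ 0 := by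
    by_cases hz : ∃ p₀ ∈ Ioo (0 : ℝ) 1, D p₀ = 0
    · obtain ⟨p₀, hp₀, hz⟩ := hz
      refine ⟨p₀, hp₀, fun p hp hne hp0 => ?_⟩
      rcases lt_or_gt_of_ne hne with h | h
      · exact hcon p hp p₀ hp₀ h hp0 hz
      · exact hcon p₀ hp₀ p hp h hz hp0
    · push Not at hz
      exact ⟨1 / 2, by norm_num, fun p hp _ => hz p hp⟩
  have hsub1 : Ioo 0 p₀ ⊆ Ioo (0 : ℝ) 1 := Ioo_subset_Ioo_right hp₀.2.le
  have hsub2 : Ioo p₀ 1 ⊆ Ioo (0 : ℝ) 1 := Ioo_subset_Ioo_left hp₀.1.le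
  have hcase : ∀ {P : ℝ → Prop}, (∀ p ∈ Ioo 0 p₀, P p) → (∀ p ∈ Ioo p₀ 1, P p) →
      ∀ p ∈ Ioo (0 : ℝ) 1, p ≠ p₀ → P p := fun ha hb p hp hne =>
    (lt_or_gt_of_ne hne).elim (fun h => ha p ⟨hp.1, h⟩) (fun h => hb p ⟨h, hp.2⟩)
  have hi : IntegrableOn (fun p => D p * (c p - c p₀)) (Ioo 0 1) := by
    simp only [mul_sub]; exact hDci.sub (hDi.mul_const _)
  have hI : ∫ p in Ioo (0 : ℝ) 1, D p * (c p - c p₀) = 0 := by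
    simp only [mul_sub]
    rw [integral_sub hDci (hDi.mul_const _), h1, integral_mul_const, h0]; simp
  rcases pos_or_neg_of_ne_zero (hD.mono hsub1) (fun p hp => hne p (hsub1 hp) hp.2.ne) with hl | hl
    <;> rcases pos_or_neg_of_ne_zero (hD.mono hsub2) (fun p hp => hne p (hsub2 hp) hp.1.ne')
      with hr | hr
  · exact absurd h0 (integral_pos_of_pos_off_point hDi (hcase hl hr)).ne'
  · have := integral_pos_of_pos_off_point (f := fun p => -(D p * (c p - c p₀))) hi.neg
      (p₀ := p₀) (hcase (fun p hp => ?_) (fun p hp => ?_))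
    · rw [integral_neg, hI] at this; simp at this
    · have := hc (hsub1 hp) hp₀ hp.2
      nlinarith [hl p hp]
    · have := hc hp₀ (hsub2 hp) hp.1
      nlinarith [hr p hp]
  · have := integral_pos_of_pos_off_point hi
      (p₀ := p₀) (hcase (fun p hp => ?_) (fun p hp => ?_))
    · rw [hI] at this; simp at this
    · have := hc (hsub1 hp) hp₀ hp.2
      nlinarith [hl p hp]
    · have := hc hp₀ (hsub2 hp) hp.1
      nlinarith [hr p hp]
  · have := integral_pos_of_pos_off_point (f := fun p => -D p) hDi.neg
      (p₀ := p₀) (hcase (fun p hp => neg_pos.2 (hl p hp)) (fun p hp => neg_pos.2 (hr p hp)))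
    rw [integral_neg, h0] at this; simp at this

lemma quadratic_coeffs_eq_zero {A B C r s t : ℝ} (hrs : r < s) (hst : s < t)
    (hr : A * r ^ 2 + B * r + C = 0) (hs : A * s ^ 2 + B * s + C = 0)
    (ht : A * t ^ 2 + B * t + C = 0) : A = 0 ∧ B = 0 := by
  have h1 : A * (r + s) + B = 0 := by
    have : (s - r) * (A * (r + s) + B) = 0 := by linear_combination hs - hr
    exact (mul_eq_zero.1 this).resolve_left (sub_pos.2 hrs).ne'
  have h2 : A * (s + t) + B = 0 := by
    have : (t - s) * (A * (s + t) + B) = 0 := by linear_combination ht - hs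
    exact (mul_eq_zero.1 this).resolve_left (sub_pos.2 hst).ne'
  have hA : A = 0 := by
    have : (t - r) * A = 0 := by linear_combination h2 - h1
    exact (mul_eq_zero.1 this).resolve_left (sub_pos.2 (hrs.trans hst)).ne'
  exact ⟨hA, by rw [hA] at h1; linarith⟩

lemma hasDerivAt_truncCDF {θ : Param} (t : ℝ) :
    HasDerivAt (truncCDF θ) (phi (θ.std t) * (1 / θ.sigma) / mass θ) t := by
  have h1 : HasDerivAt θ.std (1 / θ.sigma) t :=
    ((hasDerivAt_id t).sub_const _).div_const _
  exact (((hasDerivAt_Phi _).comp t h1).sub_const _).div_const _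

/-- Two truncated normal distributions on the same interval whose distribution functions cross
twice inside the interval coincide. -/
lemma mu_sigma_eq_of_two_crossings {θ η : Param} (hθ : θ ∈ Param.admissible)
    (hη : η ∈ Param.admissible) (hl : θ.tauL = η.tauL) (hu : θ.tauU = η.tauU) {s t : ℝ}
    (hs : θ.tauL < s) (hst : s < t) (ht : t < θ.tauU) (hs0 : truncCDF θ s = truncCDF η s)
    (ht0 : truncCDF θ t = truncCDF η t) : θ.mu = η.mu ∧ θ.sigma = η.sigma := by
  have hroot : ∀ {a b : ℝ}, a < b → truncCDF θ a = truncCDF η a → truncCDF θ b = truncCDF η b →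
      ∃ r ∈ Ioo a b, phi (θ.std r) * (1 / θ.sigma) / mass θ
        = phi (η.std r) * (1 / η.sigma) / mass η := by
    intro a b hab ha hb
    have hd : ∀ t, HasDerivAt (fun t => truncCDF θ t - truncCDF η t)
        (phi (θ.std t) * (1 / θ.sigma) / mass θ - phi (η.std t) * (1 / η.sigma) / mass η) t :=
      fun t => (hasDerivAt_truncCDF t).sub (hasDerivAt_truncCDF t)
    obtain ⟨r, hr, hr0⟩ := exists_hasDerivAt_eq_zero hab
      (fun t _ => (hd t).continuousAt.continuousWithinAt) (by rw [ha, hb]; simp)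
      (fun t _ => hd t)
    exact ⟨r, hr, sub_eq_zero.1 hr0⟩
  -- Both ends of the interval are crossings as well, with values 0 and 1, so Rolle's theorem
  -- applies on three adjacent intervals.
  obtain ⟨r₁, hr₁, e₁⟩ := hroot hs (by rw [truncCDF_tauL, hl, truncCDF_tauL]) hs0
  obtain ⟨r₂, hr₂, e₂⟩ := hroot hst hs0 ht0
  obtain ⟨r₃, hr₃, e₃⟩ := hroot ht ht0
    (by rw [truncCDF_tauU hθ, hu, truncCDF_tauU hη])
  have hσ := hθ.1
  have hσ' := hη.1
  have hm := mass_pos hθ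
  have hm' := mass_pos hη
  -- Taking logarithms of equal densities gives a quadratic equation in `r` whose coefficients do
  -- not depend on `r`.
  have hquad : ∀ {r : ℝ}, phi (θ.std r) * (1 / θ.sigma) / mass θ
        = phi (η.std r) * (1 / η.sigma) / mass η →
      (1 / θ.sigma ^ 2 - 1 / η.sigma ^ 2) * r ^ 2
        + (-2) * (θ.mu / θ.sigma ^ 2 - η.mu / η.sigma ^ 2) * r
        + (θ.mu ^ 2 / θ.sigma ^ 2 - η.mu ^ 2 / η.sigma ^ 2
          + 2 * Real.log (θ.sigma * mass θ) - 2 * Real.log (η.sigma * mass η)) = 0 := by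
    intro r h
    have hlog := congrArg Real.log h
    have hexp : ∀ {ζ : Param}, 0 < ζ.sigma → 0 < mass ζ →
        Real.log (phi (ζ.std r) * (1 / ζ.sigma) / mass ζ)
          = Real.log (√(2 * Real.pi))⁻¹ + -ζ.std r ^ 2 / 2 - Real.log (ζ.sigma * mass ζ) := by
      intro ζ h1 h2
      rw [show phi (ζ.std r) * (1 / ζ.sigma) / mass ζ = phi (ζ.std r) / (ζ.sigma * mass ζ) by
        field_simp, Real.log_div (phi_pos _).ne' (by positivity), phi_eq,
        Real.log_mul (by positivity) (Real.exp_pos _).ne', Real.log_exp]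
    rw [hexp hσ hm, hexp hσ' hm'] at hlog
    have e : ∀ {ζ : Param}, 0 < ζ.sigma → ζ.std r ^ 2 = 1 / ζ.sigma ^ 2 * r ^ 2
        - 2 * (ζ.mu / ζ.sigma ^ 2) * r + ζ.mu ^ 2 / ζ.sigma ^ 2 := by
      intro ζ h1
      unfold Param.std; field_simp; ring
    have e1 := e (ζ := θ) hσ
    have e2 := e (ζ := η) hσ'
    linear_combination -2 * hlog - e1 + e2
  obtain ⟨hA, hB⟩ := quadratic_coeffs_eq_zero (hr₁.2.trans hr₂.1) (hr₂.2.trans hr₃.1)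
    (hquad e₁) (hquad e₂) (hquad e₃)
  have hsig : θ.sigma = η.sigma := by
    have : 1 / θ.sigma ^ 2 = 1 / η.sigma ^ 2 := by linarith
    rw [one_div, one_div, inv_inj] at this
    exact (pow_left_inj₀ hσ.le hσ'.le two_ne_zero).1 this
  refine ⟨?_, hsig⟩
  rw [hsig] at hB
  field_simp at hB
  linarith

/-! ### The scores `c_{n:k}(θ)` -/

/-- The median of `Beta(h_l + k, h_u + n + 1 - k)`. -/
abbrev scoreMedian (n : ℕ) (θ : Param) (k : ℕ) : ℝ :=
  betaMedian (hl n θ + k) (hu n θ + n + 1 - k)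

/-- The score `c_{n:k}(θ)`. -/
abbrev score (n : ℕ) (θ : Param) (k : ℕ) : ℝ := xi n (hl n θ) (hu n θ) k

lemma score_eq (n : ℕ) (θ : Param) (k : ℕ) : score n θ k = Q (scoreMedian n θ k) := rfl

section Score

variable {θ : Param} {n : ℕ}

/-- Since `hl` and `hu` are `n / mass θ` times the two tail probabilities, this factor cancels in
the Beta mean. What remains is the level `Phi (θ.std θ.tauL) + k / n * mass θ`, up to the factor `1
+ mass θ / n`. -/
lemma beta_params (hθ : θ ∈ Param.admissible) (hn : 0 < n) {k : ℕ} (hk : 1 ≤ k ∧ k ≤ n) :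
    1 ≤ hl n θ + k ∧ 1 ≤ hu n θ + n + 1 - k ∧
      (n : ℝ) ≤ (hl n θ + k) + (hu n θ + n + 1 - k) ∧
      (hl n θ + k) / ((hl n θ + k) + (hu n θ + n + 1 - k))
        = (Phi (θ.std θ.tauL) + k / n * mass θ) / (1 + mass θ / n) ∧
      (hu n θ + n + 1 - k) / ((hl n θ + k) + (hu n θ + n + 1 - k))
        = (1 - Phi (θ.std θ.tauU) + (n + 1 - k) / n * mass θ) / (1 + mass θ / n) := by
  have hm := mass_pos hθ
  have hn' : (0 : ℝ) < n := by exact_mod_cast hn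
  have hk1 : (1 : ℝ) ≤ k := by exact_mod_cast hk.1
  have hk2 : (k : ℝ) ≤ n := by exact_mod_cast hk.2
  have h1 : 0 ≤ hl n θ := mul_nonneg hn'.le (div_nonneg (Phi_pos _).le hm.le)
  have h2 : 0 ≤ hu n θ :=
    mul_nonneg hn'.le (div_nonneg (by linarith [Phi_lt_one (θ.std θ.tauU)]) hm.le)
  have hsum : (hl n θ + k) + (hu n θ + n + 1 - k) = n / mass θ * (1 + mass θ / n) := by
    have hd : Phi (θ.std θ.tauU) = mass θ + Phi (θ.std θ.tauL) := by unfold mass; ring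
    rw [hl, hu, hd]
    field_simp
    ring
  have ha : hl n θ + k = n / mass θ * (Phi (θ.std θ.tauL) + k / n * mass θ) := by
    rw [hl]; field_simp
  have hb : hu n θ + n + 1 - k
      = n / mass θ * (1 - Phi (θ.std θ.tauU) + (n + 1 - k) / n * mass θ) := by
    rw [hu]; field_simp; ring
  have hnm : (n : ℝ) / mass θ ≠ 0 := by positivity
  refine ⟨by linarith, by linarith, by linarith, ?_, ?_⟩
  · rw [hsum, ha, mul_div_mul_left _ _ hnm]
  · rw [hsum, hb, mul_div_mul_left _ _ hnm]

/-- The extra 1 in the second Beta parameter compensates for rounding up, so both tails keep a bound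
without loss. -/
lemma ceil_div_bounds (hn : 0 < n) {p : ℝ} (hp : p ∈ Ioo (0 : ℝ) 1) :
    p ≤ (⌈n * p⌉₊ : ℝ) / n ∧ 1 - p ≤ (n + 1 - ⌈n * p⌉₊ : ℝ) / n := by
  have hn' : (0 : ℝ) < n := by exact_mod_cast hn
  have h1 := Nat.le_ceil ((n : ℝ) * p)
  have h2 := Nat.ceil_lt_add_one (mul_pos hn' hp.1).le
  constructor
  · rw [le_div_iff₀ hn']; linarith
  · rw [le_div_iff₀ hn']; linarith

/-- The constant is `34 = 17 * 2`, the factor 2 bounding `1 + mass θ / n`. -/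
lemma scoreMedian_lower (hθ : θ ∈ Param.admissible) (hn : 0 < n) {p : ℝ}
    (hp : p ∈ Ioo (0 : ℝ) 1) :
    (Phi (θ.std θ.tauL) + p * mass θ) / 34 ≤ scoreMedian n θ ⌈n * p⌉₊ := by
  obtain ⟨ha, hb, -, h1, -⟩ := beta_params hθ hn (ceil_mem hn hp)
  refine le_trans ?_ (betaMedian_lower ha hb)
  have hm := mass_pos hθ
  have hm1 := mass_lt_one (θ := θ)
  have hn' : (1 : ℝ) ≤ n := by exact_mod_cast hn
  have hq : mass θ / n ≤ 1 := by rw [div_le_one (by linarith)]; linarith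
  have hq0 : 0 < mass θ / n := by positivity
  have hP := Phi_pos (θ.std θ.tauL)
  have hc := mul_le_mul_of_nonneg_right (ceil_div_bounds hn hp).1 hm.le
  have hpm := mul_pos hp.1 hm
  rw [h1, div_div, div_le_div_iff₀ (by norm_num) (by positivity)]
  nlinarith

lemma scoreMedian_upper (hθ : θ ∈ Param.admissible) (hn : 0 < n) {p : ℝ}
    (hp : p ∈ Ioo (0 : ℝ) 1) :
    (1 - Phi (θ.std θ.tauU) + (1 - p) * mass θ) / 34 ≤ 1 - scoreMedian n θ ⌈n * p⌉₊ := by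
  obtain ⟨ha, hb, -, -, h1⟩ := beta_params hθ hn (ceil_mem hn hp)
  refine le_trans ?_ (betaMedian_upper ha hb)
  have hm := mass_pos hθ
  have hm1 := mass_lt_one (θ := θ)
  have hn' : (1 : ℝ) ≤ n := by exact_mod_cast hn
  have hq : mass θ / n ≤ 1 := by rw [div_le_one (by linarith)]; linarith
  have hq0 : 0 < mass θ / n := by positivity
  have hP := Phi_lt_one (θ.std θ.tauU)
  have hc := mul_le_mul_of_nonneg_right (ceil_div_bounds hn hp).2 hm.le
  have hpm := mul_pos (sub_pos.2 hp.2) hm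
  rw [h1, div_div, div_le_div_iff₀ (by norm_num) (by positivity)]
  nlinarith

lemma scoreMedian_mem (hθ : θ ∈ Param.admissible) (hn : 0 < n) {p : ℝ}
    (hp : p ∈ Ioo (0 : ℝ) 1) : scoreMedian n θ ⌈n * p⌉₊ ∈ Ioo (0 : ℝ) 1 := by
  have hm := mass_pos hθ
  have h1 := scoreMedian_lower hθ hn hp
  have h2 := scoreMedian_upper hθ hn hp
  have := Phi_pos (θ.std θ.tauL)
  have := Phi_lt_one (θ.std θ.tauU)
  have := mul_pos hp.1 hm
  have := mul_pos (sub_pos.2 hp.2) hm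
  constructor <;> linarith

lemma abs_scoreMedian_sub_le (hθ : θ ∈ Param.admissible) (hn : 0 < n) {p : ℝ}
    (hp : p ∈ Ioo (0 : ℝ) 1) :
    |scoreMedian n θ ⌈n * p⌉₊
      - (Phi (θ.std θ.tauL) + (⌈n * p⌉₊ : ℝ) / n * mass θ) / (1 + mass θ / n)| ≤ 1 / √n := by
  obtain ⟨ha, hb, hab, h1, -⟩ := beta_params hθ hn (ceil_mem hn hp)
  have hn' : (0 : ℝ) < n := by exact_mod_cast hn
  rw [← h1]
  refine (abs_betaMedian_sub_mean_le (by linarith) (by linarith)).trans ?_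
  exact one_div_le_one_div_of_le (Real.sqrt_pos.2 hn') (Real.sqrt_le_sqrt hab)

/-- The integrable envelope of the scores. -/
def envelope (κ p : ℝ) : ℝ := (8 / (κ * p)) ^ (1 / 4 : ℝ) + (8 / (κ * (1 - p))) ^ (1 / 4 : ℝ)

lemma abs_score_le_envelope (hθ : θ ∈ Param.admissible) (hn : 0 < n) {κ : ℝ} (hκ : 0 < κ)
    (hmass : 34 * κ ≤ mass θ) {p : ℝ} (hp : p ∈ Ioo (0 : ℝ) 1) :
    |score n θ ⌈n * p⌉₊| ≤ envelope κ p := by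
  have hu := scoreMedian_mem hθ hn hp
  have h1 := scoreMedian_lower hθ hn hp
  have h2 := scoreMedian_upper hθ hn hp
  have hp1 : 0 < 1 - p := sub_pos.2 hp.2
  have a1 := Phi_pos (θ.std θ.tauL)
  have a2 := Phi_lt_one (θ.std θ.tauU)
  have r1 : 0 < κ * p := mul_pos hκ hp.1
  have r2 : 0 < κ * (1 - p) := mul_pos hκ hp1
  have m1 := mul_le_mul_of_nonneg_left hmass hp.1.le
  have m2 := mul_le_mul_of_nonneg_left hmass hp1.le
  have z0 := Phi_pos 0
  have z1 := Phi_lt_one 0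
  -- Comparison with `x = 0` suffices here, since `mass θ` is bounded below and `Phi 0 < 1`.
  have l := Q_lower hu 0 r1 (by nlinarith)
  have u := Q_upper hu 0 r2 (by nlinarith)
  have e1 : 0 ≤ (8 / (κ * p)) ^ (1 / 4 : ℝ) := by positivity
  have e2 : 0 ≤ (8 / (κ * (1 - p))) ^ (1 / 4 : ℝ) := by positivity
  simp only [neg_zero, max_self, mul_zero, sub_zero, add_zero, zero_sub, zero_add] at l u
  rw [score_eq, envelope, abs_le]
  constructor <;> linarith

/-- Lower bound for the fitted values `μ + σ c_{n:k}` that is uniform in the parameter. -/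
lemma fitted_lower (hθ : θ ∈ Param.admissible) (hn : 0 < n) {p : ℝ}
    (hp : p ∈ Ioo (0 : ℝ) 1) :
    θ.tauU - 2 * max (θ.tauU - θ.mu) 0 - θ.sigma * envelope (1 / 34) p
      ≤ θ.mu + θ.sigma * score n θ ⌈n * p⌉₊ := by
  have hσ := hθ.1
  have hu := scoreMedian_mem hθ hn hp
  have h1 := scoreMedian_lower hθ hn hp
  have hp1 : 0 < 1 - p := sub_pos.2 hp.2
  have a1 := mul_pos hp1 (Phi_pos (θ.std θ.tauL))
  -- The level is the convex combination `(1 - p) Φ(τ_l*) + p Φ(τ_u*)`, hence at least `p Φ(τ_u*)`.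
  -- No lower bound on `mass θ` is needed, and `σ τ_u* = τ_u - μ` stays bounded even if `τ_u*` does
  -- not.
  have l := Q_lower hu (θ.std θ.tauU) (r := 1 / 34 * p) (by linarith [hp.1])
    (by unfold mass at h1; linarith)
  have e2 : 0 ≤ (8 / (1 / 34 * (1 - p))) ^ (1 / 4 : ℝ) := by positivity
  have hx : θ.sigma * θ.std θ.tauU = θ.tauU - θ.mu := by
    unfold Param.std; field_simp
  have hmx : θ.sigma * max (θ.std θ.tauU) 0 = max (θ.tauU - θ.mu) 0 := by
    rw [mul_max_of_nonneg _ _ hσ.le, hx, mul_zero]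
  have l2 : θ.std θ.tauU - 2 * max (θ.std θ.tauU) 0 - envelope (1 / 34) p
      ≤ score n θ ⌈n * p⌉₊ := by
    rw [score_eq, envelope]; linarith
  have l3 := mul_le_mul_of_nonneg_left l2 hσ.le
  have : θ.sigma * (θ.std θ.tauU - 2 * max (θ.std θ.tauU) 0 - envelope (1 / 34) p)
      = θ.tauU - θ.mu - 2 * max (θ.tauU - θ.mu) 0 - θ.sigma * envelope (1 / 34) p := by
    rw [← hmx, ← hx]; ring
  linarith

/-- Upper bound for the fitted values `μ + σ c_{n:k}` that is uniform in the parameter. -/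
lemma fitted_upper (hθ : θ ∈ Param.admissible) (hn : 0 < n) {p : ℝ}
    (hp : p ∈ Ioo (0 : ℝ) 1) :
    θ.mu + θ.sigma * score n θ ⌈n * p⌉₊
      ≤ θ.tauL + 2 * max (θ.mu - θ.tauL) 0 + θ.sigma * envelope (1 / 34) p := by
  have hσ := hθ.1
  have hu := scoreMedian_mem hθ hn hp
  have h1 := scoreMedian_upper hθ hn hp
  have hp1 : 0 < 1 - p := sub_pos.2 hp.2
  have a1 := mul_pos hp.1 (sub_pos.2 (Phi_lt_one (θ.std θ.tauU)))
  have l := Q_upper hu (θ.std θ.tauL) (r := 1 / 34 * (1 - p)) (by linarith)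
    (by unfold mass at h1; linarith)
  have e2 : 0 ≤ (8 / (1 / 34 * p)) ^ (1 / 4 : ℝ) := by have := hp.1; positivity
  have hx : θ.sigma * θ.std θ.tauL = θ.tauL - θ.mu := by
    unfold Param.std; field_simp
  have hmx : θ.sigma * max (-θ.std θ.tauL) 0 = max (θ.mu - θ.tauL) 0 := by
    rw [mul_max_of_nonneg _ _ hσ.le, mul_neg, hx, mul_zero, neg_sub]
  have l2 : score n θ ⌈n * p⌉₊
      ≤ θ.std θ.tauL + 2 * max (-θ.std θ.tauL) 0 + envelope (1 / 34) p := by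
    rw [score_eq, envelope]; linarith
  have l3 := mul_le_mul_of_nonneg_left l2 hσ.le
  have : θ.sigma * (θ.std θ.tauL + 2 * max (-θ.std θ.tauL) 0 + envelope (1 / 34) p)
      = θ.tauL - θ.mu + 2 * max (θ.mu - θ.tauL) 0 + θ.sigma * envelope (1 / 34) p := by
    rw [← hmx, ← hx]; ring
  linarith

end Score

/-! ### Integrability of the envelope and the limit of the scores -/

lemma integrableOn_div_rpow {κ s : ℝ} (hκ : 0 < κ) (hs : s < 1) :
    IntegrableOn (fun p : ℝ => (8 / (κ * p)) ^ s) (Ioo 0 1) := by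
  have h := intervalIntegral.intervalIntegrable_rpow' (a := 0) (b := 1) (r := -s) (by linarith)
  rw [intervalIntegrable_iff_integrableOn_Ioo_of_le zero_le_one] at h
  refine IntegrableOn.congr_fun (h.const_mul ((8 / κ) ^ s)) (fun p hp => ?_) measurableSet_Ioo
  have hp0 := hp.1
  rw [Real.rpow_neg hp0.le, ← Real.inv_rpow hp0.le, ← Real.mul_rpow (by positivity)
    (by positivity)]
  congr 1; field_simp

lemma integrableOn_div_one_sub_rpow {κ s : ℝ} (hκ : 0 < κ) (hs : s < 1) :
    IntegrableOn (fun p : ℝ => (8 / (κ * (1 - p))) ^ s) (Ioo 0 1) := by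
  have h := integrableOn_div_rpow hκ hs
  rw [← intervalIntegrable_iff_integrableOn_Ioo_of_le zero_le_one] at h ⊢
  simpa using (h.comp_sub_left 1).symm

lemma integrableOn_envelope {κ : ℝ} (hκ : 0 < κ) : IntegrableOn (envelope κ) (Ioo 0 1) :=
  (integrableOn_div_rpow hκ (by norm_num)).add (integrableOn_div_one_sub_rpow hκ (by norm_num))

/-- The second component of the estimating function is quadratic in the scores; squaring the
exponent `1/4` terms gives exponent `1/2`, still below 1. -/
lemma integrableOn_envelope_sq {κ : ℝ} (hκ : 0 < κ) :
    IntegrableOn (fun p => envelope κ p * envelope κ p) (Ioo 0 1) := by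
  have h := ((integrableOn_div_rpow hκ (s := 1 / 2) (by norm_num)).add
    (integrableOn_div_one_sub_rpow hκ (s := 1 / 2) (by norm_num))).const_mul 2
  refine h.mono' ?_ ?_
  · exact (integrableOn_envelope hκ).aestronglyMeasurable.mul
      (integrableOn_envelope hκ).aestronglyMeasurable
  · filter_upwards [ae_restrict_mem measurableSet_Ioo] with p hp
    have hsq : ∀ {y : ℝ}, 0 ≤ y → y ^ (1 / 2 : ℝ) = y ^ (1 / 4 : ℝ) * y ^ (1 / 4 : ℝ) := by
      intro y hy
      rw [← Real.rpow_add_of_nonneg hy (by norm_num) (by norm_num)]; norm_num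
    have hp0 := hp.1
    have hp1 : 0 < 1 - p := sub_pos.2 hp.2
    rw [Real.norm_of_nonneg (mul_self_nonneg _), Pi.add_apply, hsq (by positivity),
      hsq (by positivity), envelope]
    nlinarith [sq_nonneg ((8 / (κ * p)) ^ (1 / 4 : ℝ) - (8 / (κ * (1 - p))) ^ (1 / 4 : ℝ))]

/-- The median is within `1 / √n` of the mean. The limiting level lies inside `(0, 1)`, where `Q` is
continuous, even if `pl = 0` or `pu = 1`; these are the values that occur when `σ → 0`. -/
lemma tendsto_score {n : ℕ → ℕ} {θ : ℕ → Param} (hn : Tendsto n atTop atTop)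
    (hθ : ∀ j, θ j ∈ Param.admissible) {pl pu : ℝ} (h0 : 0 ≤ pl) (h1 : pu ≤ 1) (hlt : pl < pu)
    (hpl : Tendsto (fun j => Phi ((θ j).std (θ j).tauL)) atTop (𝓝 pl))
    (hpu : Tendsto (fun j => Phi ((θ j).std (θ j).tauU)) atTop (𝓝 pu))
    {p : ℝ} (hp : p ∈ Ioo (0 : ℝ) 1) :
    Tendsto (fun j => score (n j) (θ j) ⌈(n j : ℝ) * p⌉₊) atTop (𝓝 (Q (pl + p * (pu - pl)))) := by
  have hmass : Tendsto (fun j => mass (θ j)) atTop (𝓝 (pu - pl)) := hpu.sub hpl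
  have hnR : Tendsto (fun j => (n j : ℝ)) atTop atTop := tendsto_natCast_atTop_atTop.comp hn
  have hmean : Tendsto (fun j => (Phi ((θ j).std (θ j).tauL)
      + (⌈(n j : ℝ) * p⌉₊ : ℝ) / n j * mass (θ j)) / (1 + mass (θ j) / n j)) atTop
      (𝓝 (pl + p * (pu - pl))) := by
    have := (hpl.add ((tendsto_ceil_div hn hp.1.le).mul hmass)).div
      ((hmass.div_atTop hnR).const_add 1) (by norm_num)
    rw [add_zero, div_one] at this
    exact this
  have hdiff : Tendsto (fun j => scoreMedian (n j) (θ j) ⌈(n j : ℝ) * p⌉₊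
      - (Phi ((θ j).std (θ j).tauL)
      + (⌈(n j : ℝ) * p⌉₊ : ℝ) / n j * mass (θ j)) / (1 + mass (θ j) / n j)) atTop (𝓝 0) := by
    refine squeeze_zero_norm' ?_ ((tendsto_const_nhds (x := (1 : ℝ))).div_atTop
      (Real.tendsto_sqrt_atTop.comp hnR))
    filter_upwards [hn.eventually_gt_atTop 0] with j hj
    exact abs_scoreMedian_sub_le (hθ j) hj hp
  have hmed := hdiff.add hmean
  simp only [sub_add_cancel, zero_add] at hmed
  exact (continuousAt_Q (add_mul_mem_Ioo h0 h1 hlt hp)).tendsto.comp hmed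

/-! ### Limits of the estimating equations along deterministic sequences -/

lemma tendsto_setIntegral_of_dominated {f : ℕ → ℝ → ℝ} {g bound : ℝ → ℝ}
    (hm : ∀ j, Measurable (f j))
    (hb : ∀ᶠ j in atTop, ∀ p ∈ Ioo (0 : ℝ) 1, |f j p| ≤ bound p)
    (hbi : IntegrableOn bound (Ioo 0 1))
    (hlim : ∀ p ∈ Ioo (0 : ℝ) 1, Tendsto (fun j => f j p) atTop (𝓝 (g p))) :
    IntegrableOn g (Ioo 0 1) ∧
      Tendsto (fun j => ∫ p in Ioo (0 : ℝ) 1, f j p) atTop (𝓝 (∫ p in Ioo (0 : ℝ) 1, g p)) := by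
  have hmem := ae_restrict_mem (μ := (volume : Measure ℝ))
    (measurableSet_Ioo (a := (0 : ℝ)) (b := 1))
  have hae : ∀ᵐ p ∂(volume.restrict (Ioo (0 : ℝ) 1)), Tendsto (fun j => f j p) atTop (𝓝 (g p)) :=
    hmem.mono hlim
  constructor
  · refine hbi.mono' (aestronglyMeasurable_of_tendsto_ae atTop
      (fun j => (hm j).aestronglyMeasurable) hae) ?_
    filter_upwards [hmem] with p hp
    exact le_of_tendsto (hlim p hp).abs (hb.mono fun j hj => hj p hp)
  · exact tendsto_integral_filter_of_dominated_convergence bound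
      (Eventually.of_forall fun j => (hm j).aestronglyMeasurable)
      (hb.mono fun j hj => hmem.mono fun p hp => hj p hp) hbi hae

/-- A sequence of samples whose empirical distribution approaches `TN(θ₀)`, together with
approximate zeros of the observed estimating function. -/
structure ApproxSolution (θ₀ : Param) (n : ℕ → ℕ) (x : ∀ j, Fin (n j) → ℝ) (θ : ℕ → Param) :
    Prop where
  admissible₀ : θ₀ ∈ Param.admissible
  admissible : ∀ j, θ j ∈ Param.admissible
  tendsto_size : Tendsto n atTop atTop
  mem_Icc : ∀ᶠ j in atTop, ∀ i, x j i ∈ Icc θ₀.tauL θ₀.tauU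
  tendsto_ecdf : ∀ t : ℚ, (t : ℝ) ∈ Ioo θ₀.tauL θ₀.tauU →
    Tendsto (fun j => ecdf (x j) t) atTop (𝓝 (truncCDF θ₀ t))
  tendsto_obsU : Tendsto (fun j => obsU (x j) (θ j)) atTop (𝓝 0)

namespace ApproxSolution

variable {θ₀ : Param} {n : ℕ → ℕ} {x : ∀ j, Fin (n j) → ℝ} {θ : ℕ → Param}

lemma tendsto_obsU_apply (h : ApproxSolution θ₀ n x θ) (i : Fin 4) :
    Tendsto (fun j => obsU (x j) (θ j) i) atTop (𝓝 0) := by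
  have hc : Continuous fun y : Param => y i := by fun_prop
  exact (hc.tendsto 0).comp h.tendsto_obsU

lemma eventually_orderStat_mem (h : ApproxSolution θ₀ n x θ) :
    ∀ᶠ j in atTop, ∀ p ∈ Ioo (0 : ℝ) 1,
      orderStat (x j) ⌈(n j : ℝ) * p⌉₊ ∈ Icc θ₀.tauL θ₀.tauU := by
  filter_upwards [h.tendsto_size.eventually_gt_atTop 0, h.mem_Icc] with j hj hmem p hp
  obtain ⟨i, hi⟩ := exists_orderStat_eq (x j) (ceil_mem hj hp)
  rw [hi]; exact hmem i

lemma eventually_abs_orderStat_le (h : ApproxSolution θ₀ n x θ) :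
    ∀ᶠ j in atTop, ∀ p ∈ Ioo (0 : ℝ) 1,
      |orderStat (x j) ⌈(n j : ℝ) * p⌉₊| ≤ max |θ₀.tauL| |θ₀.tauU| :=
  h.eventually_orderStat_mem.mono fun _ hj p hp =>
    abs_le_max_abs_abs (hj p hp).1 (hj p hp).2

lemma tendsto_orderStat (h : ApproxSolution θ₀ n x θ) {p : ℝ} (hp : p ∈ Ioo (0 : ℝ) 1) :
    Tendsto (fun j => orderStat (x j) ⌈(n j : ℝ) * p⌉₊) atTop (𝓝 (truncQuantile θ₀ p)) :=
  tendsto_orderStat_ceil h.admissible₀ h.tendsto_size h.tendsto_ecdf hp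

lemma tendsto_residual_mean (h : ApproxSolution θ₀ n x θ) :
    Tendsto (fun j => ∫ p in Ioo (0 : ℝ) 1, (orderStat (x j) ⌈(n j : ℝ) * p⌉₊ - (θ j).mu
      - (θ j).sigma * score (n j) (θ j) ⌈(n j : ℝ) * p⌉₊)) atTop (𝓝 0) := by
  refine (h.tendsto_obsU_apply 0).congr' ?_
  filter_upwards [h.tendsto_size.eventually_gt_atTop 0] with j hj
  exact average_eq_setIntegral hj fun k =>
    orderStat (x j) k - (θ j).mu - (θ j).sigma * score (n j) (θ j) k

lemma tendsto_residual_score (h : ApproxSolution θ₀ n x θ) :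
    Tendsto (fun j => ∫ p in Ioo (0 : ℝ) 1, (orderStat (x j) ⌈(n j : ℝ) * p⌉₊ - (θ j).mu
      - (θ j).sigma * score (n j) (θ j) ⌈(n j : ℝ) * p⌉₊)
        * score (n j) (θ j) ⌈(n j : ℝ) * p⌉₊) atTop (𝓝 0) := by
  refine (h.tendsto_obsU_apply 1).congr' ?_
  filter_upwards [h.tendsto_size.eventually_gt_atTop 0] with j hj
  exact average_eq_setIntegral hj fun k =>
    (orderStat (x j) k - (θ j).mu - (θ j).sigma * score (n j) (θ j) k) * score (n j) (θ j) k

/-- In the limit the true and the fitted quantile functions agree at two points. -/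
lemma exists_two_zeros (h : ApproxSolution θ₀ n x θ) {μ σ pl pu : ℝ}
    (hμ : Tendsto (fun j => (θ j).mu) atTop (𝓝 μ))
    (hσ : Tendsto (fun j => (θ j).sigma) atTop (𝓝 σ))
    (hpl : Tendsto (fun j => Phi ((θ j).std (θ j).tauL)) atTop (𝓝 pl))
    (hpu : Tendsto (fun j => Phi ((θ j).std (θ j).tauU)) atTop (𝓝 pu)) (hlt : pl < pu) :
    ∃ p ∈ Ioo (0 : ℝ) 1, ∃ q ∈ Ioo (0 : ℝ) 1, p < q ∧
      truncQuantile θ₀ p = μ + σ * Q (pl + p * (pu - pl)) ∧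
      truncQuantile θ₀ q = μ + σ * Q (pl + q * (pu - pl)) := by
  have h0 : 0 ≤ pl := ge_of_tendsto' hpl fun j => (Phi_pos _).le
  have h1 : pu ≤ 1 := le_of_tendsto' hpu fun j => (Phi_lt_one _).le
  have hmass : Tendsto (fun j => mass (θ j)) atTop (𝓝 (pu - pl)) := hpu.sub hpl
  -- Then `34 κ` is half the limit of `mass (θ j)`, hence eventually below it.
  set κ := (pu - pl) / 68 with hκdef
  have hκ : 0 < κ := div_pos (sub_pos.2 hlt) (by norm_num)
  have hmassκ : ∀ᶠ j in atTop, 34 * κ ≤ mass (θ j) :=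
    hmass.eventually (le_mem_nhds (by rw [hκdef]; linarith))
  set K := max |θ₀.tauL| |θ₀.tauU|
  have hμb : ∀ᶠ j in atTop, |(θ j).mu| ≤ |μ| + 1 :=
    hμ.abs.eventually (ge_mem_nhds (by linarith))
  have hσb : ∀ᶠ j in atTop, |(θ j).sigma| ≤ |σ| + 1 :=
    hσ.abs.eventually (ge_mem_nhds (by linarith))
  have hscore : ∀ᶠ j in atTop, ∀ p ∈ Ioo (0 : ℝ) 1,
      |score (n j) (θ j) ⌈(n j : ℝ) * p⌉₊| ≤ envelope κ p := by
    filter_upwards [h.tendsto_size.eventually_gt_atTop 0, hmassκ] with j hj hj2 p hp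
    exact abs_score_le_envelope (h.admissible j) hj hκ hj2 hp
  have hres : ∀ᶠ j in atTop, ∀ p ∈ Ioo (0 : ℝ) 1,
      |orderStat (x j) ⌈(n j : ℝ) * p⌉₊ - (θ j).mu
        - (θ j).sigma * score (n j) (θ j) ⌈(n j : ℝ) * p⌉₊|
        ≤ (K + (|μ| + 1)) + (|σ| + 1) * envelope κ p := by
    filter_upwards [h.eventually_abs_orderStat_le, hμb, hσb, hscore] with j hx hm hs hc p hp
    refine (abs_sub _ _).trans (add_le_add ((abs_sub _ _).trans (add_le_add (hx p hp) hm)) ?_)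
    rw [abs_mul]
    exact mul_le_mul hs (hc p hp) (abs_nonneg _) (by positivity)
  have hlimc : ∀ p ∈ Ioo (0 : ℝ) 1, Tendsto (fun j => score (n j) (θ j) ⌈(n j : ℝ) * p⌉₊) atTop
      (𝓝 (Q (pl + p * (pu - pl)))) := fun p hp =>
    tendsto_score h.tendsto_size h.admissible h0 h1 hlt hpl hpu hp
  have hlimr : ∀ p ∈ Ioo (0 : ℝ) 1, Tendsto (fun j => orderStat (x j) ⌈(n j : ℝ) * p⌉₊
      - (θ j).mu - (θ j).sigma * score (n j) (θ j) ⌈(n j : ℝ) * p⌉₊) atTop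
      (𝓝 (truncQuantile θ₀ p - μ - σ * Q (pl + p * (pu - pl)))) := fun p hp =>
    ((h.tendsto_orderStat hp).sub hμ).sub (hσ.mul (hlimc p hp))
  have hmc : ∀ j, Measurable fun p : ℝ => score (n j) (θ j) ⌈(n j : ℝ) * p⌉₊ := fun j =>
    measurable_comp_ceil (n j) _
  have hmr : ∀ j, Measurable fun p : ℝ => orderStat (x j) ⌈(n j : ℝ) * p⌉₊ - (θ j).mu
      - (θ j).sigma * score (n j) (θ j) ⌈(n j : ℝ) * p⌉₊ := fun j =>
    measurable_comp_ceil (n j)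
      fun k => orderStat (x j) k - (θ j).mu - (θ j).sigma * score (n j) (θ j) k
  have hE := integrableOn_envelope hκ
  have hconst : IntegrableOn (fun _ : ℝ => K + (|μ| + 1)) (Ioo 0 1) :=
    integrableOn_const (by simp)
  obtain ⟨i1, t1⟩ := tendsto_setIntegral_of_dominated hmr hres
    (hconst.add (hE.const_mul (|σ| + 1))) hlimr
  have hb2 : IntegrableOn (fun p => ((K + (|μ| + 1)) + (|σ| + 1) * envelope κ p) * envelope κ p)
      (Ioo 0 1) := by
    simp only [add_mul _ ((|σ| + 1) * _), mul_assoc (|σ| + 1)]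
    exact (hE.const_mul _).add ((integrableOn_envelope_sq hκ).const_mul _)
  obtain ⟨i2, t2⟩ := tendsto_setIntegral_of_dominated (fun j => (hmr j).mul (hmc j))
    (by
      filter_upwards [hres, hscore] with j hr hc p hp
      simp only [Pi.mul_apply]
      rw [abs_mul]
      exact mul_le_mul (hr p hp) (hc p hp) (abs_nonneg _) ((abs_nonneg _).trans (hr p hp)))
    hb2 (fun p hp => (hlimr p hp).mul (hlimc p hp))
  have z1 := tendsto_nhds_unique t1 h.tendsto_residual_mean
  have z2 := tendsto_nhds_unique t2 h.tendsto_residual_score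
  obtain ⟨p, hp, q, hq, hpq, hp0, hq0⟩ := TruncNormal.exists_two_zeros
    (D := fun p => truncQuantile θ₀ p - μ - σ * Q (pl + p * (pu - pl)))
    (((continuousOn_truncQuantile h.admissible₀).sub continuousOn_const).sub
      (continuousOn_const.mul (continuousOn_Q_affine h0 h1 hlt)))
    (strictMonoOn_Q_affine h0 h1 hlt) i1 i2 z1 z2
  exact ⟨p, hp, q, hq, hpq, by linarith, by linarith⟩

lemma integral_truncQuantile_mem (hθ : θ₀ ∈ Param.admissible)
    (hi : IntegrableOn (truncQuantile θ₀) (Ioo 0 1)) :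
    ∫ p in Ioo (0 : ℝ) 1, truncQuantile θ₀ p ∈ Ioo θ₀.tauL θ₀.tauU := by
  have hc : ∀ a : ℝ, IntegrableOn (fun _ : ℝ => a) (Ioo 0 1) := fun a =>
    integrableOn_const (by simp)
  constructor
  · have := integral_pos_of_pos_off_point (f := fun p => truncQuantile θ₀ p - θ₀.tauL) (p₀ := 0)
      (hi.sub (hc _)) fun p hp _ => sub_pos.2 (truncQuantile_mem hθ hp).1
    rw [integral_sub hi (hc _)] at this
    simpa using this
  · have := integral_pos_of_pos_off_point (f := fun p => θ₀.tauU - truncQuantile θ₀ p) (p₀ := 0)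
      ((hc _).sub hi) fun p hp _ => sub_pos.2 (truncQuantile_mem hθ hp).2
    rw [integral_sub (hc _) hi] at this
    simpa using this

/-- If `σ → 0`, then the limit of `μ` lies strictly between the limits of the truncation bounds,
provided these enclose the true truncation interval. -/
lemma mu_mem_Ioo (h : ApproxSolution θ₀ n x θ) {μ τl τu : ℝ}
    (hμ : Tendsto (fun j => (θ j).mu) atTop (𝓝 μ))
    (hσ : Tendsto (fun j => (θ j).sigma) atTop (𝓝 0))
    (hτl : Tendsto (fun j => (θ j).tauL) atTop (𝓝 τl))
    (hτu : Tendsto (fun j => (θ j).tauU) atTop (𝓝 τu))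
    (hl : τl ≤ θ₀.tauL) (hu : θ₀.tauU ≤ τu) : μ ∈ Ioo τl τu := by
  have hconst : ∀ a : ℝ, IntegrableOn (fun _ : ℝ => a) (Ioo 0 1) := fun a =>
    integrableOn_const (by simp)
  have hE := integrableOn_envelope (κ := 1 / 34) (by norm_num)
  have hone : ∀ a : ℝ, ∫ _ in Ioo (0 : ℝ) 1, a = a := fun a => by simp
  obtain ⟨i1, t1⟩ := tendsto_setIntegral_of_dominated
    (fun j => measurable_comp_ceil (n j) (orderStat (x j))) h.eventually_abs_orderStat_le
    (hconst _) (fun p hp => h.tendsto_orderStat hp)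
  have hm := integral_truncQuantile_mem h.admissible₀ i1
  -- As the mean residual vanishes, the mean fitted value has the same limit `m` as the sample mean.
  have t2 := t1.sub h.tendsto_residual_mean
  rw [sub_zero] at t2
  set m := ∫ p in Ioo (0 : ℝ) 1, truncQuantile θ₀ p
  set I := ∫ p in Ioo (0 : ℝ) 1, envelope (1 / 34) p
  have hfit : ∀ᶠ j in atTop, (∫ p in Ioo (0 : ℝ) 1, orderStat (x j) ⌈(n j : ℝ) * p⌉₊)
      - (∫ p in Ioo (0 : ℝ) 1, (orderStat (x j) ⌈(n j : ℝ) * p⌉₊ - (θ j).mu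
        - (θ j).sigma * score (n j) (θ j) ⌈(n j : ℝ) * p⌉₊))
      = ∫ p in Ioo (0 : ℝ) 1,
        ((θ j).mu + (θ j).sigma * score (n j) (θ j) ⌈(n j : ℝ) * p⌉₊) := by
    filter_upwards [h.tendsto_size.eventually_gt_atTop 0] with j hj
    rw [← integral_sub (integrableOn_comp_ceil hj (orderStat (x j)))
      (integrableOn_comp_ceil hj
        fun k => orderStat (x j) k - (θ j).mu - (θ j).sigma * score (n j) (θ j) k)]
    refine integral_congr_ae (ae_of_all _ fun p => ?_)
    simp only
    ring
  have hintg : ∀ j, 0 < n j → IntegrableOn (fun p : ℝ =>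
      (θ j).mu + (θ j).sigma * score (n j) (θ j) ⌈(n j : ℝ) * p⌉₊) (Ioo 0 1) := fun j hj =>
    integrableOn_comp_ceil hj fun k => (θ j).mu + (θ j).sigma * score (n j) (θ j) k
  have hlow : τu - 2 * max (τu - μ) 0 ≤ m := by
    have tl := (hτu.sub (((hτu.sub hμ).max (tendsto_const_nhds (x := (0 : ℝ)))).const_mul 2)).sub
      (hσ.mul_const I)
    rw [zero_mul, sub_zero] at tl
    refine le_of_tendsto_of_tendsto tl t2 ?_
    filter_upwards [hfit, h.tendsto_size.eventually_gt_atTop 0] with j hj hn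
    rw [hj]
    have := setIntegral_mono_on ((hconst ((θ j).tauU - 2 * max ((θ j).tauU - (θ j).mu) 0)).sub
      (hE.const_mul (θ j).sigma)) (hintg j hn) measurableSet_Ioo
      fun p hp => fitted_lower (h.admissible j) hn hp
    rw [integral_sub' (hconst _) (hE.const_mul _), integral_const_mul, hone] at this
    exact this
  have hupp : m ≤ τl + 2 * max (μ - τl) 0 := by
    have tl := (hτl.add (((hμ.sub hτl).max (tendsto_const_nhds (x := (0 : ℝ)))).const_mul 2)).add
      (hσ.mul_const I)
    rw [zero_mul, add_zero] at tl
    refine le_of_tendsto_of_tendsto t2 tl ?_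
    filter_upwards [hfit, h.tendsto_size.eventually_gt_atTop 0] with j hj hn
    rw [hj]
    have := setIntegral_mono_on (hintg j hn)
      ((hconst ((θ j).tauL + 2 * max ((θ j).mu - (θ j).tauL) 0)).add
      (hE.const_mul (θ j).sigma)) measurableSet_Ioo
      fun p hp => fitted_upper (h.admissible j) hn hp
    rw [integral_add' (hconst _) (hE.const_mul _), integral_const_mul, hone] at this
    exact this
  -- If `μ` lay on or beyond a limiting bound, the positive part would vanish and `m` would be
  -- pushed to or beyond that bound, whereas `m` lies strictly inside the true interval.
  constructor
  · by_contra! hle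
    rw [max_eq_right (by linarith)] at hupp
    linarith [hm.1]
  · by_contra! hle
    rw [max_eq_right (by linarith)] at hlow
    linarith [hm.2]

end ApproxSolution

/-! ### Identification of the limit -/

lemma continuous_mu : Continuous Param.mu := by unfold Param.mu; fun_prop

lemma continuous_sigma : Continuous Param.sigma := by unfold Param.sigma; fun_prop

lemma continuous_tauL : Continuous Param.tauL := by unfold Param.tauL; fun_prop

lemma continuous_tauU : Continuous Param.tauU := by unfold Param.tauU; fun_prop

lemma Param.ext_coords {θ η : Param} (h0 : θ.mu = η.mu) (h1 : θ.sigma = η.sigma)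
    (h2 : θ.tauL = η.tauL) (h3 : θ.tauU = η.tauU) : θ = η := by
  ext i
  fin_cases i
  exacts [h0, h1, h2, h3]

/-- The correction of an extreme order statistic `y` in the last two components of the
estimating function. -/
def spacing {n : ℕ} (x : Fin n → ℝ) (θ : Param) (y : ℝ) : ℝ :=
  (Phi (θ.std (orderStat x n)) - Phi (θ.std (orderStat x 1)))
    / (((n : ℝ) - 1) * (1 / θ.sigma) * phi (θ.std y))

lemma spacing_nonneg {n : ℕ} (hn : 0 < n) (x : Fin n → ℝ) {θ : Param}
    (hθ : θ ∈ Param.admissible) (y : ℝ) : 0 ≤ spacing x θ y := by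
  have h1 := strictMono_Phi.monotone ((std_strictMono hθ).monotone
    (orderStat_mono x le_rfl hn le_rfl))
  have h2 : (1 : ℝ) ≤ n := by exact_mod_cast hn
  have h3 := hθ.1
  exact div_nonneg (by linarith) (mul_nonneg (mul_nonneg (by linarith) (by positivity))
    (phi_pos _).le)

namespace ApproxSolution

variable {θ₀ : Param} {n : ℕ → ℕ} {x : ∀ j, Fin (n j) → ℝ} {θ : ℕ → Param}

lemma tendsto_one (h : ApproxSolution θ₀ n x θ) :
    Tendsto (fun j => orderStat (x j) 1) atTop (𝓝 θ₀.tauL) :=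
  tendsto_orderStat_one h.admissible₀ h.tendsto_size h.mem_Icc h.tendsto_ecdf

lemma tendsto_last (h : ApproxSolution θ₀ n x θ) :
    Tendsto (fun j => orderStat (x j) (n j)) atTop (𝓝 θ₀.tauU) :=
  tendsto_orderStat_last h.admissible₀ h.tendsto_size h.mem_Icc h.tendsto_ecdf

lemma tendsto_spacing_lower (h : ApproxSolution θ₀ n x θ) {τl : ℝ}
    (hτl : Tendsto (fun j => (θ j).tauL) atTop (𝓝 τl)) :
    Tendsto (fun j => spacing (x j) (θ j) (orderStat (x j) 1)) atTop (𝓝 (θ₀.tauL - τl)) := by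
  have := (h.tendsto_one.sub hτl).sub (h.tendsto_obsU_apply 2)
  rw [sub_zero] at this
  refine this.congr fun j => ?_
  change _ - (orderStat (x j) 1 - spacing (x j) (θ j) (orderStat (x j) 1) - (θ j).tauL) = _
  ring

lemma tendsto_spacing_upper (h : ApproxSolution θ₀ n x θ) {τu : ℝ}
    (hτu : Tendsto (fun j => (θ j).tauU) atTop (𝓝 τu)) :
    Tendsto (fun j => spacing (x j) (θ j) (orderStat (x j) (n j))) atTop
      (𝓝 (τu - θ₀.tauU)) := by
  have := (hτu.sub h.tendsto_last).add (h.tendsto_obsU_apply 3)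
  rw [add_zero] at this
  refine this.congr fun j => ?_
  change _ + (orderStat (x j) (n j) + spacing (x j) (θ j) (orderStat (x j) (n j))
    - (θ j).tauU) = _
  ring

/-- The numerator converges, and `σ > 0` keeps the density in the denominator away from zero, so the
factor `n - 1` dominates. -/
lemma tendsto_spacing_zero (h : ApproxSolution θ₀ n x θ) {μ σ : ℝ} (hσ0 : 0 < σ)
    (hμ : Tendsto (fun j => (θ j).mu) atTop (𝓝 μ))
    (hσ : Tendsto (fun j => (θ j).sigma) atTop (𝓝 σ)) {y : ℕ → ℝ} {y₀ : ℝ}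
    (hy : Tendsto y atTop (𝓝 y₀)) :
    Tendsto (fun j => spacing (x j) (θ j) (y j)) atTop (𝓝 0) := by
  have hstd : ∀ {z : ℕ → ℝ} {z₀ : ℝ}, Tendsto z atTop (𝓝 z₀) →
      Tendsto (fun j => (θ j).std (z j)) atTop (𝓝 ((z₀ - μ) / σ)) := fun hz =>
    (hz.sub hμ).div hσ hσ0.ne'
  have hPhi : ∀ {z : ℕ → ℝ} {z₀ : ℝ}, Tendsto z atTop (𝓝 z₀) →
      Tendsto (fun j => Phi (z j)) atTop (𝓝 (Phi z₀)) := fun hz =>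
    (continuous_Phi.tendsto _).comp hz
  have hnum := (hPhi (hstd h.tendsto_last)).sub (hPhi (hstd h.tendsto_one))
  have hphi : Tendsto (fun j => phi ((θ j).std (y j))) atTop (𝓝 (phi ((y₀ - μ) / σ))) :=
    (continuous_phi.tendsto _).comp (hstd hy)
  have hn : Tendsto (fun j => (n j : ℝ) - 1) atTop atTop :=
    tendsto_atTop_add_const_right _ _ (tendsto_natCast_atTop_atTop.comp h.tendsto_size)
  have hinv : Tendsto (fun j => 1 / (θ j).sigma) atTop (𝓝 (1 / σ)) :=
    tendsto_const_nhds.div hσ hσ0.ne'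
  exact hnum.div_atTop ((hn.atTop_mul_pos (by positivity) hinv).atTop_mul_pos (phi_pos _) hphi)

/-- The only possible limit of approximate zeros of the estimating function is the true
parameter. -/
theorem limit_eq (h : ApproxSolution θ₀ n x θ) {θ' : Param}
    (hθ : Tendsto θ atTop (𝓝 θ')) : θ' = θ₀ := by
  have hμ : Tendsto (fun j => (θ j).mu) atTop (𝓝 θ'.mu) := (continuous_mu.tendsto _).comp hθ
  have hσ : Tendsto (fun j => (θ j).sigma) atTop (𝓝 θ'.sigma) :=
    (continuous_sigma.tendsto _).comp hθ
  have hτl : Tendsto (fun j => (θ j).tauL) atTop (𝓝 θ'.tauL) :=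
    (continuous_tauL.tendsto _).comp hθ
  have hτu : Tendsto (fun j => (θ j).tauU) atTop (𝓝 θ'.tauU) :=
    (continuous_tauU.tendsto _).comp hθ
  have hpos : ∀ᶠ j in atTop, 0 < n j := h.tendsto_size.eventually_gt_atTop 0
  have hle_l : θ'.tauL ≤ θ₀.tauL := sub_nonneg.1 <| ge_of_tendsto (h.tendsto_spacing_lower hτl)
    (hpos.mono fun j hj => spacing_nonneg hj _ (h.admissible j) _)
  have hle_u : θ₀.tauU ≤ θ'.tauU := sub_nonneg.1 <| ge_of_tendsto (h.tendsto_spacing_upper hτu)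
    (hpos.mono fun j hj => spacing_nonneg hj _ (h.admissible j) _)
  have hσ0 : 0 ≤ θ'.sigma := ge_of_tendsto' hσ fun j => (h.admissible j).1.le
  rcases hσ0.eq_or_lt with hs | hs
  · rw [← hs] at hσ
    have hmem := h.mu_mem_Ioo hμ hσ hτl hτu hle_l hle_u
    have hinv : Tendsto (fun j => ((θ j).sigma)⁻¹) atTop atTop :=
      tendsto_inv_nhdsGT_zero.comp (tendsto_nhdsWithin_iff.2
        ⟨hσ, Eventually.of_forall fun j => (h.admissible j).1⟩)
    have hl : Tendsto (fun j => (θ j).std (θ j).tauL) atTop atBot :=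
      (hτl.sub hμ).neg_mul_atTop (sub_neg.2 hmem.1) hinv
    have hu : Tendsto (fun j => (θ j).std (θ j).tauU) atTop atTop :=
      (hτu.sub hμ).pos_mul_atTop (sub_pos.2 hmem.2) hinv
    -- With `σ = 0` the fitted quantile function is constant, contradicting strict monotonicity of
    -- the true one.
    obtain ⟨p, hp, q, hq, hpq, hp0, hq0⟩ := h.exists_two_zeros hμ hσ
      (tendsto_Phi_atBot.comp hl) (tendsto_Phi_atTop.comp hu) zero_lt_one
    have := truncQuantile_strictMonoOn h.admissible₀ hp hq hpq
    rw [hp0, hq0] at this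
    simp at this
  · have hl : θ'.tauL = θ₀.tauL := (sub_eq_zero.1 (tendsto_nhds_unique
      (h.tendsto_spacing_lower hτl) (h.tendsto_spacing_zero hs hμ hσ h.tendsto_one))).symm
    have hu : θ'.tauU = θ₀.tauU := sub_eq_zero.1 (tendsto_nhds_unique
      (h.tendsto_spacing_upper hτu) (h.tendsto_spacing_zero hs hμ hσ h.tendsto_last))
    have hadm : θ' ∈ Param.admissible := ⟨hs, by rw [hl, hu]; exact h.admissible₀.2⟩
    have hpl : Tendsto (fun j => Phi ((θ j).std (θ j).tauL)) atTop
        (𝓝 (Phi (θ'.std θ'.tauL))) :=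
      (continuous_Phi.tendsto _).comp ((hτl.sub hμ).div hσ hs.ne')
    have hpu : Tendsto (fun j => Phi ((θ j).std (θ j).tauU)) atTop
        (𝓝 (Phi (θ'.std θ'.tauU))) :=
      (continuous_Phi.tendsto _).comp ((hτu.sub hμ).div hσ hs.ne')
    obtain ⟨p, hp, q, hq, hpq, hp0, hq0⟩ := h.exists_two_zeros hμ hσ hpl hpu
      (sub_pos.1 (mass_pos hadm))
    change _ = truncQuantile θ' p at hp0
    change _ = truncQuantile θ' q at hq0
    have hcross : ∀ {r : ℝ}, r ∈ Ioo (0 : ℝ) 1 → truncQuantile θ₀ r = truncQuantile θ' r →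
        truncCDF θ' (truncQuantile θ' r) = truncCDF θ₀ (truncQuantile θ' r) := by
      intro r hr e
      rw [truncCDF_truncQuantile hadm hr, ← e, truncCDF_truncQuantile h.admissible₀ hr]
    obtain ⟨e1, e2⟩ := mu_sigma_eq_of_two_crossings hadm h.admissible₀ hl hu
      (truncQuantile_mem hadm hp).1 (truncQuantile_strictMonoOn hadm hp hq hpq)
      (truncQuantile_mem hadm hq).2 (hcross hp hp0) (hcross hq hq0)
    exact Param.ext_coords e1 e2 hl hu

end ApproxSolution

/-! ### Convergence of the empirical distribution and conclusion -/

lemma truncNormal_Iic {θ : Param} (hθ : θ ∈ Param.admissible) {t : ℝ}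
    (ht : t ∈ Ioo θ.tauL θ.tauU) : (truncNormal θ) (Iic t) = ENNReal.ofReal (truncCDF θ t) := by
  have hcont : Continuous fun s => (1 / θ.sigma) * phi (θ.std s) / mass θ := by
    have : Continuous θ.std := by unfold Param.std; fun_prop
    exact (continuous_const.mul (continuous_phi.comp this)).div_const _
  have hind : ∀ s, ENNReal.ofReal (truncNormalPDF θ s) = (Icc θ.tauL θ.tauU).indicator
      (fun s => ENNReal.ofReal ((1 / θ.sigma) * phi (θ.std s) / mass θ)) s := by
    intro s
    by_cases hs : s ∈ Icc θ.tauL θ.tauU <;> simp [truncNormalPDF, hs]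
  have hset : Icc θ.tauL θ.tauU ∩ Iic t = Icc θ.tauL t := by
    ext s
    simp only [mem_inter_iff, mem_Icc, mem_Iic]
    exact ⟨fun h => ⟨h.1.1, h.2⟩, fun h => ⟨⟨h.1, h.2.trans ht.2.le⟩, h.2⟩⟩
  rw [truncNormal, withDensity_apply _ measurableSet_Iic]
  simp_rw [hind]
  rw [setLIntegral_indicator measurableSet_Icc, hset, ← ofReal_integral_eq_lintegral_ofReal]
  · congr 1
    rw [integral_Icc_eq_integral_Ioc, ← intervalIntegral.integral_of_le ht.1.le,
      intervalIntegral.integral_eq_sub_of_hasDerivAt (f := truncCDF θ), truncCDF_tauL, sub_zero]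
    · intro s _
      rw [mul_comm]
      exact hasDerivAt_truncCDF s
    · exact hcont.intervalIntegrable _ _
  · exact hcont.integrableOn_Icc
  · refine ae_of_all _ fun s => ?_
    have h1 := hθ.1
    have h2 := mass_pos hθ
    have h3 := phi_pos (θ.std s)
    positivity

lemma truncNormal_compl_Icc (θ : Param) : (truncNormal θ) (Icc θ.tauL θ.tauU)ᶜ = 0 := by
  rw [truncNormal, withDensity_apply _ measurableSet_Icc.compl]
  refine setLIntegral_eq_zero measurableSet_Icc.compl fun s hs => ?_
  simp [truncNormalPDF, indicator_of_notMem hs]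

section Probability

lemma ecdf_eq_average {Ω : Type*} (X : ℕ → Ω → ℝ) (n : ℕ) (ω : Ω) (t : ℝ) :
    ecdf (fun i : Fin n => X i ω) t
      = (∑ i ∈ Finset.range n, (Iic t).indicator (fun _ => (1 : ℝ)) (X i ω)) / n := by
  rw [ecdf, ← Fin.sum_univ_eq_sum_range (fun i => (Iic t).indicator (fun _ => (1 : ℝ)) (X i ω)),
    Finset.card_filter]
  push_cast
  rfl

variable {Ω : Type*} [MeasurableSpace Ω] {P : Measure Ω}

/-- The strong law of large numbers for the indicators of `X i ≤ t`; convergence at each fixed `t`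
is enough. -/
lemma tendstoInMeasure_ecdf [IsProbabilityMeasure P] {θ : Param} (hθ : θ ∈ Param.admissible)
    {X : ℕ → Ω → ℝ}
    (hindep : iIndepFun X P) (hlaw : ∀ i, HasLaw (X i) (truncNormal θ) P) {t : ℝ}
    (ht : t ∈ Ioo θ.tauL θ.tauU) :
    TendstoInMeasure P (fun n ω => ecdf (fun i : Fin n => X i ω) t) atTop
      (fun _ => truncCDF θ t) := by
  set g : ℝ → ℝ := (Iic t).indicator fun _ => (1 : ℝ)
  have hg : Measurable g := measurable_const.indicator measurableSet_Iic
  have hm : ∀ i, AEMeasurable (fun ω => g (X i ω)) P := fun i =>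
    hg.comp_aemeasurable (hlaw i).aemeasurable
  have hident : ∀ i, IdentDistrib (X i) (X 0) P P := fun i =>
    ⟨(hlaw i).aemeasurable, (hlaw 0).aemeasurable, by rw [(hlaw i).map_eq, (hlaw 0).map_eq]⟩
  have hmean : ∫ ω, g (X 0 ω) ∂P = truncCDF θ t := by
    have h0 : 0 ≤ truncCDF θ t := by
      rw [← truncCDF_tauL θ]; exact (truncCDF_strictMono hθ ht.1).le
    rw [← integral_map (f := g) (hlaw 0).aemeasurable hg.aestronglyMeasurable, (hlaw 0).map_eq,
      integral_indicator_const _ measurableSet_Iic, measureReal_def, truncNormal_Iic hθ ht,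
      ENNReal.toReal_ofReal h0, smul_eq_mul, mul_one]
  have hintg : Integrable (fun ω => g (X 0 ω)) P := by
    refine Integrable.of_bound (hm 0).aestronglyMeasurable 1 (ae_of_all _ fun ω => ?_)
    by_cases h : X 0 ω ∈ Iic t <;> simp [g, h]
  have hlln := strong_law_ae_real (fun i ω => g (X i ω)) hintg
    (fun i j hij => (hindep.indepFun hij).comp hg hg) (fun i => (hident i).comp hg)
  simp only [hmean] at hlln
  refine tendstoInMeasure_of_tendsto_ae (fun n => ?_) ?_
  · simp only [ecdf_eq_average]
    exact ((Finset.aemeasurable_fun_sum _ fun i _ => hm i).div_const _).aestronglyMeasurable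
  · filter_upwards [hlln] with ω hω
    simpa only [ecdf_eq_average] using hω

/-- The filter of events whose (outer) probability under the random sequence `s` tends to one. -/
def inProbabilityFilter {S : Type*} (P : Measure Ω) (s : ℕ → Ω → S) : Filter S where
  sets := {U | Tendsto (fun n => P {ω | s n ω ∉ U}) atTop (𝓝 0)}
  univ_sets := by simp
  sets_of_superset := by
    intro U V hU hUV
    refine tendsto_of_tendsto_of_tendsto_of_le_of_le tendsto_const_nhds hU (fun _ => zero_le)
      fun n => measure_mono fun ω hω hmem => hω (hUV hmem)
  inter_sets := by
    intro U V hU hV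
    have h := Tendsto.add hU hV
    rw [add_zero] at h
    refine tendsto_of_tendsto_of_tendsto_of_le_of_le tendsto_const_nhds h (fun _ => zero_le)
      fun n => (measure_mono fun ω hω => ?_).trans (measure_union_le _ _)
    by_contra hcon
    simp only [mem_union, mem_ofPred_eq, not_or, not_not] at hcon
    exact hω hcon

lemma mem_inProbabilityFilter {S : Type*} {s : ℕ → Ω → S} {U : Set S} :
    U ∈ inProbabilityFilter P s ↔ Tendsto (fun n => P {ω | s n ω ∉ U}) atTop (𝓝 0) := Iff.rfl

/-- Convergence in probability becomes ordinary convergence along a filter. The probabilistic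
theorem thereby reduces to a deterministic one through an inclusion of filters, with no
measurability of the estimators involved. -/
lemma tendsto_inProbabilityFilter {S E : Type*} [PseudoMetricSpace E] {s : ℕ → Ω → S}
    {f : S → E} {a : E} :
    Tendsto f (inProbabilityFilter P s) (𝓝 a) ↔
      TendstoInMeasure P (fun n ω => f (s n ω)) atTop (fun _ => a) := by
  rw [Metric.tendsto_nhds, tendstoInMeasure_iff_dist]
  refine forall₂_congr fun ε _ => ?_
  simp only [Filter.Eventually, mem_inProbabilityFilter, mem_ofPred_eq, not_lt]

end Probability

/-- Pairs of a sample of arbitrary size and a parameter in `Θ`. -/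
abbrev SampleParam (Θ : Set Param) : Type := Σ n : ℕ, (Fin n → ℝ) × Θ

/-- The filter along which samples look like samples from `TN(θ₀)` and parameters are approximate
zeros of the observed estimating function. -/
def approxFilter (Θ : Set Param) (θ₀ : Param) : Filter (SampleParam Θ) :=
  comap (fun s => s.1) atTop ⊓ 𝓟 {s | ∀ i, s.2.1 i ∈ Icc θ₀.tauL θ₀.tauU} ⊓
    (⨅ t : {t : ℚ // (t : ℝ) ∈ Ioo θ₀.tauL θ₀.tauU},
      comap (fun s => ecdf s.2.1 (t : ℚ)) (𝓝 (truncCDF θ₀ (t : ℚ)))) ⊓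
    comap (fun s => obsU s.2.1 (s.2.2 : Param)) (𝓝 0)

-- Countability of the rationals enters here; it allows limits along this filter to be tested on
-- sequences.
instance (Θ : Set Param) (θ₀ : Param) : (approxFilter Θ θ₀).IsCountablyGenerated := by
  unfold approxFilter; infer_instance

lemma approxSolution_of_tendsto {Θ : Set Param} (hΘ : Θ ⊆ Param.admissible) {θ₀ : Param}
    (hθ₀ : θ₀ ∈ Θ) {s : ℕ → SampleParam Θ} (hs : Tendsto s atTop (approxFilter Θ θ₀)) :
    ApproxSolution θ₀ (fun j => (s j).1) (fun j => (s j).2.1) (fun j => (s j).2.2) := by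
  simp only [approxFilter, tendsto_inf, tendsto_iInf, tendsto_comap_iff, tendsto_principal] at hs
  obtain ⟨⟨⟨h1, h2⟩, h3⟩, h4⟩ := hs
  exact ⟨hΘ hθ₀, fun j => hΘ (s j).2.2.2, h1, h2, fun t ht => h3 ⟨t, ht⟩, h4⟩

/-- Every sequence along the filter has a subsequence with convergent parameters, because `Θ` is
bounded in finite dimension, and `limit_eq` identifies the limit. -/
lemma tendsto_param_approxFilter {Θ : Set Param} (hΘ : Θ ⊆ Param.admissible)
    (hbdd : Bornology.IsBounded Θ) {θ₀ : Param} (hθ₀ : θ₀ ∈ Θ) :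
    Tendsto (fun s : SampleParam Θ => (s.2.2 : Param)) (approxFilter Θ θ₀) (𝓝 θ₀) := by
  refine tendsto_of_subseq_tendsto fun s hs => ?_
  obtain ⟨θ', -, φ, hφ, hlim⟩ := tendsto_subseq_of_bounded hbdd fun j => (s j).2.2.2
  refine ⟨φ, ?_⟩
  have := (approxSolution_of_tendsto hΘ hθ₀ (hs.comp hφ.tendsto_atTop)).limit_eq hlim
  rw [← this]
  exact hlim

/-- The law of a random sample and an approximate zero of the estimating function concentrates
along `approxFilter`. -/
lemma inProbabilityFilter_le_approxFilter {Ω : Type*} [MeasurableSpace Ω] {P : Measure Ω}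
    [IsProbabilityMeasure P] {Θ : Set Param} {θ₀ : Param} (hθ₀ : θ₀ ∈ Param.admissible)
    {X : ℕ → Ω → ℝ} (hindep : iIndepFun X P) (hlaw : ∀ i, HasLaw (X i) (truncNormal θ₀) P)
    {θhat : ℕ → Ω → Θ}
    (hθhat : TendstoInMeasure P
      (fun n ω => obsU (fun i : Fin n => X i ω) (θhat n ω : Param)) atTop (fun _ => 0)) :
    inProbabilityFilter P (fun n ω => (⟨n, fun i => X i ω, θhat n ω⟩ : SampleParam Θ))
      ≤ approxFilter Θ θ₀ := by
  refine le_inf (le_inf (le_inf ?_ ?_) (le_iInf fun t => ?_)) ?_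
  · rw [← tendsto_iff_comap, tendsto_atTop]
    intro b
    rw [Filter.Eventually, mem_inProbabilityFilter]
    refine tendsto_const_nhds.congr' ?_
    filter_upwards [eventually_ge_atTop b] with n hn
    simp [hn]
  · rw [le_principal_iff, mem_inProbabilityFilter]
    have hmem : ∀ᵐ ω ∂P, ∀ i, X i ω ∈ Icc θ₀.tauL θ₀.tauU := by
      rw [ae_all_iff]
      intro i
      refine ae_of_ae_map (hlaw i).aemeasurable ?_
      rw [(hlaw i).map_eq]
      exact truncNormal_compl_Icc θ₀
    refine tendsto_const_nhds.congr fun n => ?_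
    symm
    rw [ae_iff] at hmem
    refine measure_mono_null (fun ω hω => ?_) hmem
    exact fun hall => hω fun i => hall i
  · rw [← tendsto_iff_comap, tendsto_inProbabilityFilter]
    exact tendstoInMeasure_ecdf hθ₀ hindep hlaw t.2
  · rw [← tendsto_iff_comap, tendsto_inProbabilityFilter]
    exact hθhat

end TruncNormal

end

theorem mainTheorem1 {Ω : Type*} [MeasurableSpace Ω] (P : Measure Ω) [IsProbabilityMeasure P]
    (Θ : Set TruncNormal.Param) (hΘ : Θ ⊆ TruncNormal.Param.admissible)
    (hΘ_bdd : Bornology.IsBounded Θ)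
    (θ₀ : TruncNormal.Param) (hθ₀ : θ₀ ∈ Θ)
    (X : ℕ → Ω → ℝ) (hX_indep : iIndepFun X P)
    (hX_law : ∀ i, HasLaw (X i) (TruncNormal.truncNormal θ₀) P)
    (θhat : ℕ → Ω → TruncNormal.Param) (hθhat_mem : ∀ n ω, θhat n ω ∈ Θ)
    (hθhat : TendstoInMeasure P
      (fun n ω => TruncNormal.obsU (fun i : Fin n => X i ω) (θhat n ω)) atTop (fun _ => 0)) :
    TendstoInMeasure P θhat atTop (fun _ => θ₀) := by
  have hle := TruncNormal.inProbabilityFilter_le_approxFilter (hΘ hθ₀) hX_indep hX_law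
    (θhat := fun n ω => ⟨θhat n ω, hθhat_mem n ω⟩) hθhat
  exact TruncNormal.tendsto_inProbabilityFilter.1
    ((TruncNormal.tendsto_param_approxFilter hΘ hΘ_bdd hθ₀).mono_left hle)
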